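/- A Wang tile is a unit square with colored edges, written $(a,b,c,d)$ where $a,b,c,d$ are the colors of its right, top, left and bottom edge. Let $\mathcal U$ be the set of the following 19 Wang tiles, each written as the word $abcd$, with vertical colors $A,\dots,J$ and horizontal colors $K,\dots,P$: FOJO, FOHL, JMFP, DMFK, HPJP, HPHN, HKFP, HKDP, BOIO, GLEO, GLCL, ALIO, EPGP, EPIP, IPGK, IPIK, IKBM, IKAK, CNIP. Let $\Omega_{\mathcal U}\subset\mathcal U^{\mathbb Z^2}$ be its Wang shift, i.e. the set of all $x:\mathbb Z^2\to\mathcal U$ such that for every $\mathbf n\in\mathbb Z^2$ the right color of $x(\mathbf n)$ is the left color of $x(\mathbf n+\mathbf e_1)$ and the top color of $x(\mathbf n)$ is the bottom color of $x(\mathbf n+\mathbf e_2)$. It is a subshift: it is closed in the product topology ($\mathcal U$ being discrete) and invariant under the shifts $(\sigma^{\mathbf n}x)_{\mathbf m}=x_{\mathbf m+\mathbf n}$. For an alphabet $\mathcal A$, a 2-dimensional word is a rectangular array $u:\{0,\dots,n_1-1\}\times\{0,\dots,n_2-1\}\to\mathcal A$ with $n_1,n_2\ge1$; $(n_1,n_2)$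 is its shape, and letters are the words of shape $(1,1)$. For $i\in\{1,2\}$ the concatenation $u\odot^i v$ puts $v$ next to $u$ in direction $\mathbf e_i$; it is well-defined if the shapes of $u$ and $v$ agree in the other direction. A 2-dimensional morphism on a set $D$ of words is a map $\omega$ from $D$ to words such that, whenever $u,v\in D$ and $u\odot^i v$ is well-defined and in $D$, the concatenation $\omega(u)\odot^i\omega(v)$ is well-defined and equals $\omega(u\odot^i v)$. If $D$ contains all letters and all words occurring in the elements of a subshift $X\subset\mathcal A^{\mathbb Z^2}$, then $\omega$ extends to $X$: $\omega(x)$ is obtained by replacing each letter $x_{\mathbf m}$ by the rectangle $\omega(x_{\mathbf m})$, these rectangles fitting together into a configuration on $\mathbb Z^2$ in which the lower left corner of $\omega(x_{\mathbf 0})$ is at the origin. If moreover $\omega(D)\subseteq D$, then $\omega$ is called expansive if for every letter $a$ and every $K\in\mathbb N$ there is an $m\in\mathbb N$ such that both sides of $\omega^m(a)$ are larger than $K$. **Theorem.** The Wang shift $\Omega_{\mathcal U}$ is self-similar, aperiodic and minimal, that is: * (self-similar) there are a set $D$ of 2-dimensional words over $\mathcal U$ that is closed under taking (nonempty) rectangular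 subwords and contains all letters and all words occurring in elements of $\Omega_{\mathcal U}$, and an expansive 2-dimensional morphism $\omega:D\to D$, such that $\Omega_{\mathcal U}=\{\sigma^{\mathbf k}\omega(x)\mid \mathbf k\in\mathbb Z^2,\ x\in\Omega_{\mathcal U}\}$; * (aperiodic) $\Omega_{\mathcal U}\ne\varnothing$, and $\sigma^{\mathbf n}x\ne x$ for every $x\in\Omega_{\mathcal U}$ and every $\mathbf n\in\mathbb Z^2\setminus\{\mathbf 0\}$; * (minimal) $\Omega_{\mathcal U}$ contains no nonempty, proper, closed, shift-invariant subset. -/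

import Mathlib

open SymbolicDynamics.FullShift (shift Subshift)

namespace WangShift

/-! ### Two-dimensional words -/

/-- A (nonempty) two-dimensional word over `A`: a rectangular array of letters of shape
`(width, height)`. The letter at `(0, 0)` is the lower left one. -/
structure Word (A : Type*) where
  width : ℕ
  height : ℕ
  width_pos : 0 < width
  height_pos : 0 < height
  letter : Fin width → Fin height → A

namespace Word

variable {A : Type*}

/-- The position `(a, b)` lies in the word `u`, and `u` has the letter `c` there. -/
def At (u : Word A) (a b : ℕ) (c : A) : Prop :=
  ∃ (ha : a < u.width) (hb : b < u.height), u.letter ⟨a, ha⟩ ⟨b, hb⟩ = c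

/-- A letter, seen as a word of shape `(1, 1)`. -/
def single (a : A) : Word A where
  width := 1
  height := 1
  width_pos := Nat.one_pos
  height_pos := Nat.one_pos
  letter := fun _ _ => a

/-- The concatenation of `u` and `v` in direction `e₁` (`v` to the right of `u`) is well-defined
and equal to `w`. -/
def IsConcat₁ (u v w : Word A) : Prop :=
  u.height = v.height ∧ w.height = u.height ∧ w.width = u.width + v.width ∧
    (∀ a b c, u.At a b c → w.At a b c) ∧
    (∀ a b c, v.At a b c → w.At (u.width + a) b c)

/-- The concatenation of `u` and `v` in direction `e₂` (`v` on top of `u`) is well-defined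
and equal to `w`. -/
def IsConcat₂ (u v w : Word A) : Prop :=
  u.width = v.width ∧ w.width = u.width ∧ w.height = u.height + v.height ∧
    (∀ a b c, u.At a b c → w.At a b c) ∧
    (∀ a b c, v.At a b c → w.At a (u.height + b) c)

/-- `u` is a subword (factor) of `v`: it occurs in `v` at some position `(p, q)`. -/
def IsFactor (u v : Word A) : Prop :=
  ∃ p q : ℕ, ∀ a b c, u.At a b c → v.At (p + a) (q + b) c

/-- `u` is a subword of the configuration `x : ℤ² → A`. -/
def OccursIn (u : Word A) (x : ℤ × ℤ → A) : Prop :=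
  ∃ p q : ℤ, ∀ (a b : ℕ) (c : A), u.At a b c → x (p + a, q + b) = c

end Word

/-! ### Two-dimensional morphisms -/

section Morphisms

variable {A B : Type*}

/-- A set of words (a language) that contains every subword of each of its elements. -/
def IsFactorial (D : Set (Word A)) : Prop :=
  ∀ u v : Word A, u.IsFactor v → v ∈ D → u ∈ D

/-- `ω` restricts to a two-dimensional morphism on the set of words `D`: whenever a concatenation
of words of `D` is well-defined and lies in `D`, the concatenation of the images, in the same
direction, is well-defined and is the image of the concatenation. (The values of `ω` outside `D`
are irrelevant.) -/
structure IsMorphismOn (D : Set (Word A)) (ω : Word A → Word B) : Prop where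
  concat₁ : ∀ u ∈ D, ∀ v ∈ D, ∀ w ∈ D, Word.IsConcat₁ u v w → Word.IsConcat₁ (ω u) (ω v) (ω w)
  concat₂ : ∀ u ∈ D, ∀ v ∈ D, ∀ w ∈ D, Word.IsConcat₂ u v w → Word.IsConcat₂ (ω u) (ω v) (ω w)

/-- `ω` is expansive: both sides of `ω^m(a)` become arbitrarily large, for every letter `a`. -/
def IsExpansive (ω : Word A → Word A) : Prop :=
  ∀ (a : A) (K : ℕ), ∃ m : ℕ,
    K < min (ω^[m] (Word.single a)).width (ω^[m] (Word.single a)).height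

/-- `y = ω(x)` for configurations `x` and `y`: the plane is cut along vertical lines `X i` and
horizontal lines `Y j`, with `X 0 = Y 0 = 0`, into rectangles such that the rectangle with lower
left corner `(X i, Y j)` has the shape of the image of the letter `x (i, j)` and is filled in `y`
by this image. -/
def IsImage (ω : Word A → Word B) (x : ℤ × ℤ → A) (y : ℤ × ℤ → B) : Prop :=
  ∃ X Y : ℤ → ℤ, X 0 = 0 ∧ Y 0 = 0 ∧
    (∀ i j : ℤ, X (i + 1) = X i + (ω (Word.single (x (i, j)))).width) ∧
    (∀ i j : ℤ, Y (j + 1) = Y j + (ω (Word.single (x (i, j)))).height) ∧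
    ∀ (i j : ℤ) (a b : ℕ) (c : B), (ω (Word.single (x (i, j)))).At a b c →
      y (X i + a, Y j + b) = c

/-- The shift-closure of the image under `ω` of a set `S` of configurations: all shifts of images
of elements of `S`. -/
def shiftClosureImage (ω : Word A → Word B) (S : Set (ℤ × ℤ → A)) : Set (ℤ × ℤ → B) :=
  {z | ∃ k : ℤ × ℤ, ∃ x ∈ S, ∃ y, IsImage ω x y ∧ z = shift k y}

end Morphisms

/-! ### Properties of two-dimensional subshifts -/

section Subshifts

variable {A : Type*} [TopologicalSpace A]

/-- The language of a subshift: all words that occur in one of its elements. -/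
def language (X : Subshift A (ℤ × ℤ)) : Set (Word A) :=
  {u | ∃ x ∈ X.carrier, u.OccursIn x}

/-- A subshift `X` is self-similar if it is the shift-closure of its own image under an expansive
two-dimensional morphism `ω`. The domain `D` of `ω` is a factorial set of words that contains all
letters and all words of the language of `X`, and `ω` maps `D` to itself, so that all powers of
`ω` are defined on `D`, and `ω` is determined on `D` by the images of the letters. -/
def IsSelfSimilar (X : Subshift A (ℤ × ℤ)) : Prop :=
  ∃ (D : Set (Word A)) (ω : Word A → Word A),
    IsFactorial D ∧ (∀ a : A, Word.single a ∈ D) ∧ language X ⊆ D ∧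
    Set.MapsTo ω D D ∧ IsMorphismOn D ω ∧ IsExpansive ω ∧
    X.carrier = shiftClosureImage ω X.carrier

/-- A subshift is aperiodic if it is nonempty and none of its elements has a nonzero period. -/
def IsAperiodic (X : Subshift A (ℤ × ℤ)) : Prop :=
  X.carrier.Nonempty ∧ ∀ x ∈ X.carrier, ∀ n : ℤ × ℤ, n ≠ 0 → shift n x ≠ x

/-- A subshift is minimal if it contains no nonempty, proper, closed, shift-invariant subset. -/
def IsMinimal (X : Subshift A (ℤ × ℤ)) : Prop :=
  ∀ Y : Subshift A (ℤ × ℤ), Y.carrier.Nonempty → Y.carrier ⊆ X.carrier → Y.carrier = X.carrier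

end Subshifts

/-! ### Wang tiles -/

/-- A Wang tile `(right, top, left, bottom)`, with colors in `I` on the vertical edges and
in `J` on the horizontal edges. -/
structure WangTile (I J : Type*) where
  right : I
  top : J
  left : I
  bottom : J
deriving DecidableEq

/-- Wang tiles carry the discrete topology. -/
instance (I J : Type*) : TopologicalSpace (WangTile I J) := ⊥

instance (I J : Type*) : DiscreteTopology (WangTile I J) := ⟨rfl⟩

/-- The set of valid tilings `x : ℤ² → T`: adjacent edges have the same color. -/
def tilings {I J : Type*} (T : Finset (WangTile I J)) : Set (ℤ × ℤ → T) :=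
  {x | ∀ n : ℤ × ℤ, (x n).1.right = (x (n + (1, 0))).1.left ∧
    (x n).1.top = (x (n + (0, 1))).1.bottom}

theorem isClosed_tilings {I J : Type*} (T : Finset (WangTile I J)) : IsClosed (tilings T) := by
  have h : tilings T = ⋂ n : ℤ × ℤ,
      (fun x : ℤ × ℤ → T => (x n, x (n + (1, 0)), x (n + (0, 1)))) ⁻¹'
        {p | p.1.1.right = p.2.1.1.left ∧ p.1.1.top = p.2.2.1.bottom} := by
    ext x
    simp [tilings]
  rw [h]
  refine isClosed_iInter fun n => IsClosed.preimage (by fun_prop) (isClosed_discrete _)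

/-- The Wang shift of a finite set of Wang tiles: the subshift of all valid tilings. -/
def wangShift {I J : Type*} (T : Finset (WangTile I J)) : Subshift T (ℤ × ℤ) where
  carrier := tilings T
  isClosed := isClosed_tilings T
  mapsTo := fun g x hx n => by
    simpa [shift, add_assoc] using hx (g + n)

/-- The colors of the vertical edges. -/
inductive VColor
  | A | B | C | D | E | F | G | H | I | J
deriving DecidableEq

/-- The colors of the horizontal edges. -/
inductive HColor
  | K | L | M | N | O | P
deriving DecidableEq

/-- The set of 19 Wang tiles, each one written as `(right, top, left, bottom)`. -/
def tileSetU : Finset (WangTile VColor HColor) :=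
  {⟨.F, .O, .J, .O⟩, ⟨.F, .O, .H, .L⟩, ⟨.J, .M, .F, .P⟩, ⟨.D, .M, .F, .K⟩,
   ⟨.H, .P, .J, .P⟩, ⟨.H, .P, .H, .N⟩, ⟨.H, .K, .F, .P⟩, ⟨.H, .K, .D, .P⟩,
   ⟨.B, .O, .I, .O⟩, ⟨.G, .L, .E, .O⟩, ⟨.G, .L, .C, .L⟩, ⟨.A, .L, .I, .O⟩,
   ⟨.E, .P, .G, .P⟩, ⟨.E, .P, .I, .P⟩, ⟨.I, .P, .G, .K⟩, ⟨.I, .P, .I, .K⟩,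
   ⟨.I, .K, .B, .M⟩, ⟨.I, .K, .A, .K⟩, ⟨.C, .N, .I, .P⟩}

theorem card_tileSetU : tileSetU.card = 19 := by decide

end WangShift

/-!
Call a tile narrow if its horizontal colors are `L` or `O`, and low if its vertical colors are
`D`, `F`, `H` or `J`; the other tiles are wide, respectively high. Opposite edges of a tile agree
in this respect, so in a tiling a column is entirely narrow or entirely wide, and a row entirely
low or entirely high. Local arguments on `2 × 2` squares (`idx_mem_toRight_toUp`) rule out all
pairs of adjacent tiles but 31 horizontal and 35 vertical ones; in particular two adjacent columns
are never both narrow, and two adjacent rows never both low. Cut the plane on the left of the wide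
columns and below the high rows. The rectangles that arise have sides `1` or `2`, there are 19 of
them, and they fit together exactly as the 19 tiles do. This gives the substitution `omega`, in
which narrow tiles have images of width `1` and low tiles images of height `1`, and it shows that
every tiling is, up to a shift, the image of a tiling (`omega_desubstitutes`). Conversely `omega`
is compatible with the colors, so it acts on the set of all validly tiled words and sends tilings
to tilings. This is self-similarity.

Aperiodicity: the cuts can be read off from a tiling, so a period of a tiling induces a period of
its desubstitution, which is at most `2 / 3` as long because two adjacent columns of the
desubstitution come from at least three columns of the tiling (`period_eq_zero`).
Existence of a tiling follows by compactness from the existence of arbitrarily large valid words.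

Minimality: every word in a tiling lies in the image of a `2 × 2` word of a tiling under a large
power of `omega` (`Substitution.occursEverywhere_of_occursAt`). So it suffices that each of the 50
words of shape `(2, 2)` in the language occurs in the image of every tile under some power of
`omega`. One of them is the image of the tile `14`, which occurs in the fourth image of every
tile, and each of the others is obtained from it by repeatedly passing to a subword of the image
(`genealogy`).
-/

open SymbolicDynamics.FullShift (shift Subshift)

namespace WangShift

/-! ### Intervals cut into pieces of given lengths -/

section Cuts

variable {n : ℕ → ℕ}

/-- The left end of the `i`-th piece when `ℕ` is cut into consecutive pieces of lengths
`n 0, n 1, …`. -/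
def cut (n : ℕ → ℕ) (i : ℕ) : ℕ := ∑ k ∈ Finset.range i, n k

/-- The index of the piece that contains `p`, when `ℕ` is cut into consecutive pieces of positive
lengths `n 0, n 1, …`. -/
def cell (n : ℕ → ℕ) (p : ℕ) : ℕ := Nat.findGreatest (fun i => cut n i ≤ p) p

@[simp] theorem cut_zero : cut n 0 = 0 := rfl

theorem cut_succ (i : ℕ) : cut n (i + 1) = cut n i + n i := Finset.sum_range_succ _ _

theorem cut_strictMono (hn : ∀ k, 0 < n k) : StrictMono (cut n) :=
  strictMono_nat_of_lt_succ fun i => by have := hn i; rw [cut_succ]; omega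

theorem lt_of_cut_add_lt (hn : ∀ k, 0 < n k) {i a k : ℕ} (h : cut n i + a < cut n k) : i < k :=
  (cut_strictMono hn).lt_iff_lt.1 (by omega)

theorem cut_add_lt (hn : ∀ k, 0 < n k) {i a k : ℕ} (hi : i < k) (ha : a < n i) :
    cut n i + a < cut n k := by
  have := (cut_strictMono hn).monotone (Nat.succ_le_of_lt hi)
  rw [Nat.succ_eq_add_one, cut_succ] at this
  omega

theorem cell_cut_add (hn : ∀ k, 0 < n k) {i a : ℕ} (ha : a < n i) :
    cell n (cut n i + a) = i := by
  have h1 : i ≤ cut n i := (cut_strictMono hn).le_apply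
  rw [cell, Nat.findGreatest_eq_iff]
  refine ⟨by omega, fun _ => by omega, fun k hk _ h => ?_⟩
  have := cut_add_lt hn hk ha
  omega

theorem exists_eq_cut_add (hn : ∀ k, 0 < n k) (p : ℕ) : ∃ i a, a < n i ∧ p = cut n i + a := by
  induction p with
  | zero => exact ⟨0, 0, hn 0, rfl⟩
  | succ p ih =>
    obtain ⟨i, a, ha, rfl⟩ := ih
    rcases Nat.lt_or_ge (a + 1) (n i) with h | h
    · exact ⟨i, a + 1, h, rfl⟩
    · exact ⟨i + 1, 0, hn _, by rw [cut_succ]; omega⟩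

theorem cut_congr {m : ℕ → ℕ} {i : ℕ} (h : ∀ k < i, n k = m k) : cut n i = cut m i :=
  Finset.sum_congr rfl fun k hk => h k (Finset.mem_range.1 hk)

theorem cut_add (p i : ℕ) : cut n (p + i) = cut n p + cut (fun k => n (p + k)) i :=
  Finset.sum_range_add _ _ _

end Cuts

/-! ### Words as functions, and words at a position -/

namespace Word

variable {A : Type*}

/-- The letter of `u` at `(a, b)`, extended to all `a` and `b` by repeating the last column and the
top row. -/
def get (u : Word A) (a b : ℕ) : A :=
  u.letter ⟨min a (u.width - 1), by have := u.width_pos; omega⟩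
    ⟨min b (u.height - 1), by have := u.height_pos; omega⟩

theorem at_iff {u : Word A} {a b : ℕ} {c : A} :
    u.At a b c ↔ a < u.width ∧ b < u.height ∧ u.get a b = c := by
  constructor
  · rintro ⟨ha, hb, rfl⟩
    refine ⟨ha, hb, ?_⟩
    unfold get
    congr 2 <;> omega
  · rintro ⟨ha, hb, rfl⟩
    refine ⟨ha, hb, ?_⟩
    unfold get
    congr 2 <;> omega

theorem at_get {u : Word A} {a b : ℕ} (ha : a < u.width) (hb : b < u.height) :
    u.At a b (u.get a b) := at_iff.2 ⟨ha, hb, rfl⟩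

@[simp] theorem get_single (a : A) (i j : ℕ) : (single a).get i j = a := rfl

@[simp] theorem width_single (a : A) : (single a).width = 1 := rfl

@[simp] theorem height_single (a : A) : (single a).height = 1 := rfl

/-- The word of shape `(w, h)` whose letters are given by `f`. -/
def ofFun (w h : ℕ) (hw : 0 < w) (hh : 0 < h) (f : ℕ → ℕ → A) : Word A :=
  ⟨w, h, hw, hh, fun i j => f i j⟩

theorem ofFun_at {w h : ℕ} {hw : 0 < w} {hh : 0 < h} {f : ℕ → ℕ → A} {a b : ℕ} {c : A} :
    (ofFun w h hw hh f).At a b c ↔ a < w ∧ b < h ∧ f a b = c :=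
  ⟨fun ⟨ha, hb, e⟩ => ⟨ha, hb, e⟩, fun ⟨ha, hb, e⟩ => ⟨ha, hb, e⟩⟩

/-- The word `u` occurs in the word `v` at the position `(p, q)`. -/
def FactorAt (u v : Word A) (p q : ℕ) : Prop :=
  ∀ a b c, u.At a b c → v.At (p + a) (q + b) c

/-- The word `u` occurs in the configuration `x` at the position `(p, q)`. -/
def OccursAt (u : Word A) (x : ℤ × ℤ → A) (p q : ℤ) : Prop :=
  ∀ (a b : ℕ) (c : A), u.At a b c → x (p + a, q + b) = c

theorem FactorAt.get_eq {u v : Word A} {p q : ℕ} (h : u.FactorAt v p q) {a b : ℕ}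
    (ha : a < u.width) (hb : b < u.height) : v.get (p + a) (q + b) = u.get a b :=
  (at_iff.1 (h a b _ (at_get ha hb))).2.2

theorem FactorAt.add_width_le {u v : Word A} {p q : ℕ} (h : u.FactorAt v p q) :
    p + u.width ≤ v.width := by
  have h1 := u.width_pos
  have := (at_iff.1 (h (u.width - 1) 0 _ (at_get (by omega) u.height_pos))).1
  omega

theorem FactorAt.add_height_le {u v : Word A} {p q : ℕ} (h : u.FactorAt v p q) :
    q + u.height ≤ v.height := by
  have h1 := u.height_pos
  have := (at_iff.1 (h 0 (u.height - 1) _ (at_get u.width_pos (by omega)))).2.1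
  omega

theorem FactorAt.of_get {u v : Word A} {p q : ℕ} (hw : p + u.width ≤ v.width)
    (hh : q + u.height ≤ v.height)
    (h : ∀ a < u.width, ∀ b < u.height, v.get (p + a) (q + b) = u.get a b) :
    u.FactorAt v p q := by
  intro a b c hc
  obtain ⟨ha, hb, rfl⟩ := at_iff.1 hc
  exact at_iff.2 ⟨by omega, by omega, h a ha b hb⟩

theorem IsFactor.refl (u : Word A) : u.IsFactor u :=
  ⟨0, 0, fun a b c h => by simpa using h⟩

theorem IsFactor.trans {u v w : Word A} (h : u.IsFactor v) (h' : v.IsFactor w) :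
    u.IsFactor w := by
  obtain ⟨p, q, h⟩ := h
  obtain ⟨p', q', h'⟩ := h'
  exact ⟨p' + p, q' + q, fun a b c hc => by simpa [add_assoc] using h' _ _ _ (h a b c hc)⟩

theorem OccursAt.get_eq {u : Word A} {x : ℤ × ℤ → A} {p q : ℤ} (h : u.OccursAt x p q) {a b : ℕ}
    (ha : a < u.width) (hb : b < u.height) : x (p + a, q + b) = u.get a b :=
  h a b _ (at_get ha hb)

theorem OccursAt.of_factorAt {u v : Word A} {x : ℤ × ℤ → A} {p q : ℤ} {i j : ℕ}
    (h : v.OccursAt x p q) (h' : u.FactorAt v i j) : u.OccursAt x (p + i) (q + j) := by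
  intro a b c hc
  have := h _ _ _ (h' a b c hc)
  push_cast at this
  simpa [add_assoc] using this

theorem occursAt_single {a : A} {x : ℤ × ℤ → A} {p q : ℤ} (h : x (p, q) = a) :
    (single a).OccursAt x p q := by
  intro i j c hc
  obtain ⟨hi, hj, rfl⟩ := at_iff.1 hc
  simp only [width_single, height_single, Nat.lt_one_iff] at hi hj
  subst hi hj
  simpa using h

/-- The word of shape `(w, h)` at the position `(p, q)` of the configuration `x`. -/
def window (x : ℤ × ℤ → A) (p q : ℤ) (w h : ℕ) (hw : 0 < w) (hh : 0 < h) : Word A :=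
  ofFun w h hw hh fun a b => x (p + a, q + b)

theorem window_occursAt (x : ℤ × ℤ → A) (p q : ℤ) (w h : ℕ) (hw : 0 < w) (hh : 0 < h) :
    (window x p q w h hw hh).OccursAt x p q :=
  fun _ _ _ hc => (ofFun_at.1 hc).2.2

end Word

/-! ### Valid words -/

section Valid

variable {I J : Type*} {T : Finset (WangTile I J)}

/-- A word over the set of tiles `T` is valid if adjacent edges have the same color. -/
def IsValid (u : Word T) : Prop :=
  (∀ a b, a + 1 < u.width → b < u.height →
    (u.get a b).1.right = (u.get (a + 1) b).1.left) ∧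
  (∀ a b, a < u.width → b + 1 < u.height →
    (u.get a b).1.top = (u.get a (b + 1)).1.bottom)

theorem isValid_single (t : T) : IsValid (Word.single t) :=
  ⟨fun a b h => by simp at h, fun a b _ h => by simp at h⟩

theorem IsValid.of_factorAt {u v : Word T} {p q : ℕ} (hv : IsValid v) (h : u.FactorAt v p q) :
    IsValid u := by
  have h1 := h.add_width_le
  have h2 := h.add_height_le
  refine ⟨fun a b ha hb => ?_, fun a b ha hb => ?_⟩
  · rw [← h.get_eq (by omega) hb, ← h.get_eq ha hb]
    exact hv.1 (p + a) (q + b) (by omega) (by omega)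
  · rw [← h.get_eq ha (by omega), ← h.get_eq ha hb]
    exact hv.2 (p + a) (q + b) (by omega) (by omega)

theorem IsValid.of_occursAt {u : Word T} {x : ℤ × ℤ → T} {p q : ℤ} (hx : x ∈ tilings T)
    (h : u.OccursAt x p q) : IsValid u := by
  refine ⟨fun a b ha hb => ?_, fun a b ha hb => ?_⟩
  · rw [← h.get_eq (by omega) hb, ← h.get_eq ha hb]
    simpa [add_assoc] using (hx (p + a, q + b)).1
  · rw [← h.get_eq ha (by omega), ← h.get_eq ha hb]
    simpa [add_assoc] using (hx (p + a, q + b)).2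

end Valid

/-! ### Substitutions on Wang tiles -/

/-- A substitution on a set `T` of Wang tiles: the tile `t` is replaced by a rectangle of tiles,
whose width is determined by the color of the bottom edge of `t` and whose height by the color of
the left edge, in such a way that the rectangles are validly tiled, and that rectangles which
replace adjacent tiles fit together. The tile at the position `(i, j)` of the rectangle is
`img t i j`; the values of `img t` outside the rectangle are irrelevant. -/
structure Substitution {I J : Type*} (T : Finset (WangTile I J)) where
  width : J → ℕ
  height : I → ℕ
  img : T → ℕ → ℕ → T
  width_pos : ∀ c, 0 < width c
  height_pos : ∀ c, 0 < height c
  width_top : ∀ t : T, width t.1.top = width t.1.bottom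
  height_right : ∀ t : T, height t.1.right = height t.1.left
  inner₁ : ∀ (t : T) (i j : ℕ), i + 1 < width t.1.bottom → j < height t.1.left →
    (img t i j).1.right = (img t (i + 1) j).1.left
  inner₂ : ∀ (t : T) (i j : ℕ), i < width t.1.bottom → j + 1 < height t.1.left →
    (img t i j).1.top = (img t i (j + 1)).1.bottom
  outer₁ : ∀ (s t : T) (i j : ℕ), s.1.right = t.1.left → i + 1 = width s.1.bottom →
    j < height s.1.left → (img s i j).1.right = (img t 0 j).1.left
  outer₂ : ∀ (s t : T) (i j : ℕ), s.1.top = t.1.bottom → i < width s.1.bottom →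
    j + 1 = height s.1.left → (img s i j).1.top = (img t i 0).1.bottom

namespace Substitution

variable {I J : Type*} {T : Finset (WangTile I J)} (S : Substitution T)

/-- The width of the image of the `k`-th column of a word. -/
def colWidth (u : Word T) (k : ℕ) : ℕ := S.width (u.get k 0).1.bottom

/-- The height of the image of the `k`-th row of a word. -/
def rowHeight (u : Word T) (k : ℕ) : ℕ := S.height (u.get 0 k).1.left

theorem colWidth_pos (u : Word T) (k : ℕ) : 0 < S.colWidth u k := S.width_pos _

theorem rowHeight_pos (u : Word T) (k : ℕ) : 0 < S.rowHeight u k := S.height_pos _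

/-- The image of a word under a substitution. -/
def apply (u : Word T) : Word T :=
  Word.ofFun (cut (S.colWidth u) u.width) (cut (S.rowHeight u) u.height)
    ((cut_strictMono (S.colWidth_pos u)) u.width_pos)
    ((cut_strictMono (S.rowHeight_pos u)) u.height_pos)
    fun p q => S.img (u.get (cell (S.colWidth u) p) (cell (S.rowHeight u) q))
      (p - cut (S.colWidth u) (cell (S.colWidth u) p))
      (q - cut (S.rowHeight u) (cell (S.rowHeight u) q))

theorem width_apply (u : Word T) : (S.apply u).width = cut (S.colWidth u) u.width := rfl

theorem height_apply (u : Word T) : (S.apply u).height = cut (S.rowHeight u) u.height := rfl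

theorem get_apply (u : Word T) {i j a b : ℕ} (hi : i < u.width) (hj : j < u.height)
    (ha : a < S.colWidth u i) (hb : b < S.rowHeight u j) :
    (S.apply u).get (cut (S.colWidth u) i + a) (cut (S.rowHeight u) j + b)
      = S.img (u.get i j) a b := by
  refine (Word.at_iff.1 (Word.ofFun_at.2 ⟨?_, ?_, ?_⟩)).2.2
  · exact cut_add_lt (S.colWidth_pos u) hi ha
  · exact cut_add_lt (S.rowHeight_pos u) hj hb
  · rw [cell_cut_add (S.colWidth_pos u) ha, cell_cut_add (S.rowHeight_pos u) hb,
      Nat.add_sub_cancel_left, Nat.add_sub_cancel_left]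

@[simp] theorem width_apply_single (t : T) :
    (S.apply (Word.single t)).width = S.width t.1.bottom := by
  simp [width_apply, cut, colWidth]

@[simp] theorem height_apply_single (t : T) :
    (S.apply (Word.single t)).height = S.height t.1.left := by
  simp [height_apply, cut, rowHeight]

theorem apply_single_at {t c : T} {a b : ℕ} : (S.apply (Word.single t)).At a b c ↔
    a < S.width t.1.bottom ∧ b < S.height t.1.left ∧ S.img t a b = c := by
  rw [Word.at_iff, width_apply_single, height_apply_single]
  refine and_congr_right fun ha => and_congr_right fun hb => ?_
  have := S.get_apply (Word.single t) (i := 0) (j := 0) (a := a) (b := b)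
    (by simp) (by simp) ha hb
  rw [cut_zero, cut_zero, zero_add, zero_add, Word.get_single] at this
  rw [this]

variable {S}

theorem width_get {u : Word T} (hu : IsValid u) {a b : ℕ} (ha : a < u.width) (hb : b < u.height) :
    S.width (u.get a b).1.bottom = S.colWidth u a := by
  induction b with
  | zero => rfl
  | succ b ih => rw [← hu.2 a b ha hb, S.width_top, ih (by omega)]

theorem height_get {u : Word T} (hu : IsValid u) {a b : ℕ} (ha : a < u.width) (hb : b < u.height) :
    S.height (u.get a b).1.left = S.rowHeight u b := by
  induction a with
  | zero => rfl
  | succ a ih => rw [← hu.1 a b ha hb, S.height_right, ih (by omega)]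

/-- The image of a valid word is valid. -/
theorem isValid_apply {u : Word T} (hu : IsValid u) : IsValid (S.apply u) := by
  refine ⟨fun p q hp hq => ?_, fun p q hp hq => ?_⟩
  · obtain ⟨i, a, ha, rfl⟩ := exists_eq_cut_add (S.colWidth_pos u) p
    obtain ⟨j, b, hb, rfl⟩ := exists_eq_cut_add (S.rowHeight_pos u) q
    have hi := lt_of_cut_add_lt (S.colWidth_pos u) (Nat.lt_of_succ_lt hp)
    have hj := lt_of_cut_add_lt (S.rowHeight_pos u) hq
    have hb' := hb
    rw [← height_get hu hi hj] at hb'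
    rw [S.get_apply u hi hj ha hb]
    rcases Nat.lt_or_ge (a + 1) (S.colWidth u i) with h | h
    · rw [add_assoc, S.get_apply u hi hj h hb]
      exact S.inner₁ _ _ _ (by rwa [width_get hu hi hj]) hb'
    · have e : cut (S.colWidth u) i + a + 1 = cut (S.colWidth u) (i + 1) + 0 := by
        rw [cut_succ]; omega
      rw [e] at hp ⊢
      have hi' := lt_of_cut_add_lt (S.colWidth_pos u) hp
      rw [S.get_apply u hi' hj (S.colWidth_pos u _) hb]
      exact S.outer₁ _ _ _ _ (hu.1 i j hi' hj) (by rw [width_get hu hi hj]; omega) hb'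
  · obtain ⟨i, a, ha, rfl⟩ := exists_eq_cut_add (S.colWidth_pos u) p
    obtain ⟨j, b, hb, rfl⟩ := exists_eq_cut_add (S.rowHeight_pos u) q
    have hi := lt_of_cut_add_lt (S.colWidth_pos u) hp
    have hj := lt_of_cut_add_lt (S.rowHeight_pos u) (Nat.lt_of_succ_lt hq)
    have ha' := ha
    rw [← width_get hu hi hj] at ha'
    rw [S.get_apply u hi hj ha hb]
    rcases Nat.lt_or_ge (b + 1) (S.rowHeight u j) with h | h
    · rw [add_assoc, S.get_apply u hi hj ha h]
      exact S.inner₂ _ _ _ ha' (by rwa [height_get hu hi hj])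
    · have e : cut (S.rowHeight u) j + b + 1 = cut (S.rowHeight u) (j + 1) + 0 := by
        rw [cut_succ]; omega
      rw [e] at hq ⊢
      have hj' := lt_of_cut_add_lt (S.rowHeight_pos u) hq
      rw [S.get_apply u hi hj' ha (S.rowHeight_pos u _)]
      exact S.outer₂ _ _ _ _ (hu.2 i j hi hj') ha' (by rw [height_get hu hi hj]; omega)

theorem isValid_iterate {u : Word T} (hu : IsValid u) (n : ℕ) : IsValid (S.apply^[n] u) := by
  induction n with
  | zero => exact hu
  | succ n ih => rw [Function.iterate_succ_apply']; exact isValid_apply ih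

theorem colWidth_of_factorAt {u v : Word T} {p q : ℕ} (hv : IsValid v) (h : u.FactorAt v p q)
    {k : ℕ} (hk : k < u.width) : S.colWidth v (p + k) = S.colWidth u k := by
  have h1 := h.add_width_le
  have h2 := h.add_height_le
  have h3 := u.height_pos
  rw [← width_get hv (b := q) (by omega) (by omega), colWidth, ← h.get_eq hk u.height_pos, add_zero]

theorem rowHeight_of_factorAt {u v : Word T} {p q : ℕ} (hv : IsValid v) (h : u.FactorAt v p q)
    {k : ℕ} (hk : k < u.height) : S.rowHeight v (q + k) = S.rowHeight u k := by
  have h1 := h.add_width_le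
  have h2 := h.add_height_le
  have h3 := u.width_pos
  rw [← height_get hv (a := p) (by omega) (by omega), rowHeight, ← h.get_eq u.width_pos hk,
    add_zero]

theorem cut_colWidth_of_factorAt {u v : Word T} {p q : ℕ} (hv : IsValid v) (h : u.FactorAt v p q)
    {k : ℕ} (hk : k ≤ u.width) :
    cut (S.colWidth v) (p + k) = cut (S.colWidth v) p + cut (S.colWidth u) k := by
  rw [cut_add, cut_congr fun i hi => colWidth_of_factorAt hv h (lt_of_lt_of_le hi hk)]

theorem cut_rowHeight_of_factorAt {u v : Word T} {p q : ℕ} (hv : IsValid v) (h : u.FactorAt v p q)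
    {k : ℕ} (hk : k ≤ u.height) :
    cut (S.rowHeight v) (q + k) = cut (S.rowHeight v) q + cut (S.rowHeight u) k := by
  rw [cut_add, cut_congr fun i hi => rowHeight_of_factorAt hv h (lt_of_lt_of_le hi hk)]

/-- The image of a subword of a valid word `v` is a subword of the image of `v`, at the position
given by the cuts. -/
theorem factorAt_apply {u v : Word T} {p q : ℕ} (hv : IsValid v) (h : u.FactorAt v p q) :
    (S.apply u).FactorAt (S.apply v) (cut (S.colWidth v) p) (cut (S.rowHeight v) q) := by
  have h1 := h.add_width_le
  have h2 := h.add_height_le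
  refine Word.FactorAt.of_get ?_ ?_ fun a ha b hb => ?_
  · rw [width_apply, width_apply, ← cut_colWidth_of_factorAt hv h le_rfl]
    exact (cut_strictMono (S.colWidth_pos v)).monotone h1
  · rw [height_apply, height_apply, ← cut_rowHeight_of_factorAt hv h le_rfl]
    exact (cut_strictMono (S.rowHeight_pos v)).monotone h2
  · obtain ⟨i, a, ha', rfl⟩ := exists_eq_cut_add (S.colWidth_pos u) a
    obtain ⟨j, b, hb', rfl⟩ := exists_eq_cut_add (S.rowHeight_pos u) b
    have hi := lt_of_cut_add_lt (S.colWidth_pos u) ha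
    have hj := lt_of_cut_add_lt (S.rowHeight_pos u) hb
    rw [← add_assoc, ← add_assoc, ← cut_colWidth_of_factorAt hv h hi.le,
      ← cut_rowHeight_of_factorAt hv h hj.le, S.get_apply u hi hj ha' hb',
      S.get_apply v (by omega) (by omega) (by rwa [colWidth_of_factorAt hv h hi])
        (by rwa [rowHeight_of_factorAt hv h hj]), h.get_eq hi hj]

theorem isFactor_iterate {u v : Word T} (hv : IsValid v) (h : u.IsFactor v) (n : ℕ) :
    (S.apply^[n] u).IsFactor (S.apply^[n] v) := by
  induction n with
  | zero => exact h
  | succ n ih =>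
    rw [Function.iterate_succ_apply', Function.iterate_succ_apply']
    obtain ⟨p, q, h⟩ := ih
    exact ⟨_, _, factorAt_apply (isValid_iterate hv n) h⟩

variable (S)

theorem isMorphismOn : IsMorphismOn {u | IsValid u} S.apply where
  concat₁ := by
    rintro u _ v _ w hw ⟨h1, h2, h3, hu, hv⟩
    have hu' : u.FactorAt w 0 0 := fun a b c hc => by simpa using hu a b c hc
    have hv' : v.FactorAt w u.width 0 := fun a b c hc => by simpa using hv a b c hc
    have e1 := cut_rowHeight_of_factorAt (S := S) hw hu' le_rfl
    have e2 := cut_rowHeight_of_factorAt (S := S) hw hv' le_rfl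
    have e3 := cut_colWidth_of_factorAt (S := S) hw hu' le_rfl
    have e4 := cut_colWidth_of_factorAt (S := S) hw hv' le_rfl
    simp only [zero_add, cut_zero] at e1 e2 e3
    refine ⟨?_, ?_, ?_, fun a b c hc => ?_, fun a b c hc => ?_⟩
    · rw [height_apply, height_apply, ← e1, ← e2, h1]
    · rw [height_apply, height_apply, ← e1, h2]
    · rw [width_apply, width_apply, width_apply, h3, e4, e3]
    · simpa using factorAt_apply (S := S) hw hu' a b c hc
    · simpa [width_apply, e3] using factorAt_apply (S := S) hw hv' a b c hc
  concat₂ := by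
    rintro u _ v _ w hw ⟨h1, h2, h3, hu, hv⟩
    have hu' : u.FactorAt w 0 0 := fun a b c hc => by simpa using hu a b c hc
    have hv' : v.FactorAt w 0 u.height := fun a b c hc => by simpa using hv a b c hc
    have e1 := cut_colWidth_of_factorAt (S := S) hw hu' le_rfl
    have e2 := cut_colWidth_of_factorAt (S := S) hw hv' le_rfl
    have e3 := cut_rowHeight_of_factorAt (S := S) hw hu' le_rfl
    have e4 := cut_rowHeight_of_factorAt (S := S) hw hv' le_rfl
    simp only [zero_add, cut_zero] at e1 e2 e3
    refine ⟨?_, ?_, ?_, fun a b c hc => ?_, fun a b c hc => ?_⟩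
    · rw [width_apply, width_apply, ← e1, ← e2, h1]
    · rw [width_apply, width_apply, ← e1, h2]
    · rw [height_apply, height_apply, height_apply, h3, e4, e3]
    · simpa using factorAt_apply (S := S) hw hu' a b c hc
    · simpa [height_apply, e3] using factorAt_apply (S := S) hw hv' a b c hc

end Substitution

/-! ### Images of configurations -/

theorem sub_le_sub_of_forall_lt_succ {X : ℤ → ℤ} (hX : ∀ i, X i < X (i + 1)) {i j : ℤ}
    (h : i ≤ j) : j - i ≤ X j - X i := by
  induction j, h using Int.leInduction with
  | base => simp
  | succ j _ ih => have := hX j; omega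

theorem exists_le_lt_succ {X : ℤ → ℤ} (hX : ∀ i, X i < X (i + 1)) (p : ℤ) :
    ∃ i, X i ≤ p ∧ p < X (i + 1) := by
  obtain ⟨i, hi, hmax⟩ := Int.exists_greatest_of_bdd (P := fun i => X i ≤ p)
    ⟨max 0 (p - X 0), fun i hi => by
      by_contra h
      have := sub_le_sub_of_forall_lt_succ hX (i := 0) (j := i) (by omega)
      omega⟩
    ⟨min 0 (p - X 0), by
      have := sub_le_sub_of_forall_lt_succ hX (i := min 0 (p - X 0)) (j := 0) (by omega)
      omega⟩
  exact ⟨i, hi, not_le.1 fun h => by have := hmax _ h; omega⟩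

namespace Substitution

variable {I J : Type*} {T : Finset (WangTile I J)} (S : Substitution T)

/-- `z` is a shift of the image of `x` under the substitution `S`, where the image of the tile
`x (i, j)` has its lower left corner at `(X i, Y j)`. -/
structure IsCutImage (x z : ℤ × ℤ → T) (X Y : ℤ → ℤ) : Prop where
  width : ∀ i j, X (i + 1) = X i + S.width (x (i, j)).1.bottom
  height : ∀ i j, Y (j + 1) = Y j + S.height (x (i, j)).1.left
  img : ∀ (i j : ℤ) (a b : ℕ), a < S.width (x (i, j)).1.bottom → b < S.height (x (i, j)).1.left →
    z (X i + a, Y j + b) = S.img (x (i, j)) a b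

variable {S}

namespace IsCutImage

variable {x z : ℤ × ℤ → T} {X Y : ℤ → ℤ}

theorem lt_succ₁ (h : S.IsCutImage x z X Y) (i : ℤ) : X i < X (i + 1) := by
  have := S.width_pos (x (i, 0)).1.bottom
  have := h.width i 0
  omega

theorem lt_succ₂ (h : S.IsCutImage x z X Y) (j : ℤ) : Y j < Y (j + 1) := by
  have := S.height_pos (x (0, j)).1.left
  have := h.height 0 j
  omega

theorem isCutImage_shift (h : S.IsCutImage x z X Y) (k : ℤ × ℤ) :
    S.IsCutImage x (shift k z) (fun i => X i - k.1) (fun j => Y j - k.2) where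
  width i j := by have := h.width i j; omega
  height i j := by have := h.height i j; omega
  img i j a b ha hb := by
    rw [← h.img i j a b ha hb]
    simp only [shift]
    congr 1
    ext <;> simp <;> ring

/-- Every position lies in the image of some tile. -/
theorem exists_eq_add (h : S.IsCutImage x z X Y) (p q : ℤ) : ∃ (i j : ℤ) (a b : ℕ),
    a < S.width (x (i, j)).1.bottom ∧ b < S.height (x (i, j)).1.left ∧
    p = X i + a ∧ q = Y j + b := by
  obtain ⟨i, hi, hi'⟩ := exists_le_lt_succ h.lt_succ₁ p
  obtain ⟨j, hj, hj'⟩ := exists_le_lt_succ h.lt_succ₂ q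
  have := h.width i j
  have := h.height i j
  exact ⟨i, j, (p - X i).toNat, (q - Y j).toNat, by omega, by omega, by omega, by omega⟩

/-- The image of a valid tiling is a valid tiling. -/
theorem mem_tilings (h : S.IsCutImage x z X Y) (hx : x ∈ tilings T) : z ∈ tilings T := by
  rintro ⟨p, q⟩
  obtain ⟨i, j, a, b, ha, hb, rfl, rfl⟩ := h.exists_eq_add p q
  have h1 := h.width i j
  have h2 := h.height i j
  have hr : (x (i, j)).1.right = (x (i + 1, j)).1.left := by simpa using (hx (i, j)).1
  have ht : (x (i, j)).1.top = (x (i, j + 1)).1.bottom := by simpa using (hx (i, j)).2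
  rw [h.img i j a b ha hb]
  simp only [Prod.mk_add_mk, add_zero]
  constructor
  · rcases Nat.lt_or_ge (a + 1) (S.width (x (i, j)).1.bottom) with h' | h'
    · have := h.img i j (a + 1) b h' hb
      push_cast at this
      rw [add_assoc, this]
      exact S.inner₁ _ _ _ h' hb
    · have e : X i + a + 1 = X (i + 1) + (0 : ℕ) := by push_cast; omega
      rw [e, h.img (i + 1) j 0 b (S.width_pos _) (by rwa [← hr, S.height_right])]
      exact S.outer₁ _ _ _ _ hr (by omega) hb
  · rcases Nat.lt_or_ge (b + 1) (S.height (x (i, j)).1.left) with h' | h'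
    · have := h.img i j a (b + 1) ha h'
      push_cast at this
      rw [add_assoc (Y j), this]
      exact S.inner₂ _ _ _ ha h'
    · have e : Y j + b + 1 = Y (j + 1) + (0 : ℕ) := by push_cast; omega
      rw [e, h.img i (j + 1) a 0 (by rwa [← ht, S.width_top]) (S.height_pos _)]
      exact S.outer₂ _ _ _ _ ht ha (by omega)

/-- The image of a word that occurs in `x` occurs in the image of `x`, at the position given by the
cuts. -/
theorem occursAt_apply (h : S.IsCutImage x z X Y) {u : Word T} (hu : IsValid u) {p q : ℤ}
    (hp : u.OccursAt x p q) : (S.apply u).OccursAt z (X p) (Y q) ∧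
      X (p + u.width) = X p + (S.apply u).width ∧
      Y (q + u.height) = Y q + (S.apply u).height := by
  have hX : ∀ k ≤ u.width, X (p + k) = X p + cut (S.colWidth u) k := by
    intro k hk
    induction k with
    | zero => simp
    | succ k ih =>
      have h1 := h.width (p + k) (q + (0 : ℕ))
      rw [hp.get_eq hk u.height_pos, ih (by omega)] at h1
      rw [cut_succ, colWidth]
      push_cast
      rw [← add_assoc, h1]
      ring
  have hY : ∀ k ≤ u.height, Y (q + k) = Y q + cut (S.rowHeight u) k := by
    intro k hk
    induction k with
    | zero => simp
    | succ k ih =>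
      have h1 := h.height (p + (0 : ℕ)) (q + k)
      rw [hp.get_eq u.width_pos hk, ih (by omega)] at h1
      rw [cut_succ, rowHeight]
      push_cast
      rw [← add_assoc, h1]
      ring
  refine ⟨?_, hX _ le_rfl, hY _ le_rfl⟩
  intro a b c hc
  obtain ⟨ha, hb, rfl⟩ := Word.at_iff.1 hc
  obtain ⟨i, a, ha', rfl⟩ := exists_eq_cut_add (S.colWidth_pos u) a
  obtain ⟨j, b, hb', rfl⟩ := exists_eq_cut_add (S.rowHeight_pos u) b
  have hi := lt_of_cut_add_lt (S.colWidth_pos u) ha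
  have hj := lt_of_cut_add_lt (S.rowHeight_pos u) hb
  have h1 := h.img (p + i) (q + j) a b
  rw [hp.get_eq hi hj, width_get hu hi hj, height_get hu hi hj, hX i hi.le, hY j hj.le] at h1
  rw [S.get_apply u hi hj ha' hb', ← h1 ha' hb']
  push_cast
  simp only [add_assoc]

end IsCutImage

theorem isImage_iff {x z : ℤ × ℤ → T} : IsImage S.apply x z ↔
    ∃ X Y : ℤ → ℤ, X 0 = 0 ∧ Y 0 = 0 ∧ S.IsCutImage x z X Y := by
  constructor
  · rintro ⟨X, Y, hX, hY, h1, h2, h3⟩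
    simp only [width_apply_single, height_apply_single] at h1 h2
    exact ⟨X, Y, hX, hY, h1, h2, fun i j a b ha hb =>
      h3 i j a b _ (S.apply_single_at.2 ⟨ha, hb, rfl⟩)⟩
  · rintro ⟨X, Y, hX, hY, h1, h2, h3⟩
    refine ⟨X, Y, hX, hY, ?_, ?_, fun i j a b c hc => ?_⟩
    · simpa only [width_apply_single] using h1
    · simpa only [height_apply_single] using h2
    · obtain ⟨ha, hb, rfl⟩ := S.apply_single_at.1 hc
      exact h3 i j a b ha hb

variable (S)

/-- Every tiling can be desubstituted: it is a shift of the image of some tiling. -/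
def Desubstitutes : Prop :=
  ∀ z ∈ tilings T, ∃ x ∈ tilings T, ∃ X Y, S.IsCutImage x z X Y

/-- The substitution of colors that underlies `S` makes every rectangle grow: the image of the image
of a tile is wider and higher than the image of the tile. -/
structure Grows : Prop where
  width : ∀ t : T, S.width t.1.bottom <
    cut (fun i => S.width (S.img t i 0).1.bottom) (S.width t.1.bottom)
  height : ∀ t : T, S.height t.1.left <
    cut (fun j => S.height (S.img t 0 j).1.left) (S.height t.1.left)

variable {S}

theorem Desubstitutes.carrier_eq (hS : S.Desubstitutes) :
    (wangShift T).carrier = shiftClosureImage S.apply (wangShift T).carrier := by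
  ext z
  constructor
  · intro hz
    obtain ⟨x, hx, X, Y, h⟩ := hS z hz
    refine ⟨(-X 0, -Y 0), x, hx, shift (X 0, Y 0) z,
      isImage_iff.2 ⟨_, _, by simp, by simp, h.isCutImage_shift _⟩, funext fun n => ?_⟩
    simp only [shift, ← add_assoc, Prod.mk_add_mk, add_neg_cancel]
    exact congrArg z (zero_add n).symm
  · rintro ⟨k, x, hx, y, hy, rfl⟩
    obtain ⟨X, Y, -, -, h⟩ := isImage_iff.1 hy
    exact (wangShift T).mapsTo k (h.mem_tilings hx)

/-! ### Expansive substitutions -/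

theorem Grows.width_add_le (hS : S.Grows) (u : Word T) :
    (S.apply u).width + u.width ≤ (S.apply (S.apply u)).width := by
  have key : ∀ i ≤ u.width,
      cut (S.colWidth u) i + i ≤ cut (S.colWidth (S.apply u)) (cut (S.colWidth u) i) := by
    intro i hi
    induction i with
    | zero => simp
    | succ i ih =>
      have h := hS.width (u.get i 0)
      have e : cut (fun k => S.colWidth (S.apply u) (cut (S.colWidth u) i + k)) (S.colWidth u i)
          = cut (fun k => S.width (S.img (u.get i 0) k 0).1.bottom) (S.colWidth u i) := by
        refine cut_congr fun k hk => ?_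
        rw [colWidth, ← S.get_apply u (i := i) (j := 0) hi u.height_pos hk (S.rowHeight_pos u _)]
        rfl
      rw [cut_succ, cut_add, e]
      have := ih (by omega)
      simp only [colWidth] at h this ⊢
      omega
  exact key _ le_rfl

theorem Grows.height_add_le (hS : S.Grows) (u : Word T) :
    (S.apply u).height + u.height ≤ (S.apply (S.apply u)).height := by
  have key : ∀ i ≤ u.height,
      cut (S.rowHeight u) i + i ≤ cut (S.rowHeight (S.apply u)) (cut (S.rowHeight u) i) := by
    intro i hi
    induction i with
    | zero => simp
    | succ i ih =>
      have h := hS.height (u.get 0 i)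
      have e : cut (fun k => S.rowHeight (S.apply u) (cut (S.rowHeight u) i + k))
          (S.rowHeight u i)
          = cut (fun k => S.height (S.img (u.get 0 i) 0 k).1.left) (S.rowHeight u i) := by
        refine cut_congr fun k hk => ?_
        rw [rowHeight, ← S.get_apply u (i := 0) (j := i) u.width_pos hi (S.colWidth_pos u _) hk]
        rfl
      rw [cut_succ, cut_add, e]
      have := ih (by omega)
      simp only [rowHeight] at h this ⊢
      omega
  exact key _ le_rfl

theorem Grows.lt_iterate (hS : S.Grows) (u : Word T) (m : ℕ) :
    m < (S.apply^[m + 1] u).width ∧ m < (S.apply^[m + 1] u).height := by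
  induction m with
  | zero => exact ⟨Word.width_pos _, Word.height_pos _⟩
  | succ m ih =>
    have h1 := hS.width_add_le (S.apply^[m] u)
    have h2 := hS.height_add_le (S.apply^[m] u)
    have h3 := (S.apply^[m] u).width_pos
    have h4 := (S.apply^[m] u).height_pos
    simp only [← Function.iterate_succ_apply' S.apply, Nat.succ_eq_add_one] at h1 h2
    omega

theorem Grows.isExpansive (hS : S.Grows) : IsExpansive S.apply :=
  fun _ K => ⟨K + 1, lt_min (hS.lt_iterate _ K).1 (hS.lt_iterate _ K).2⟩

theorem isSelfSimilar (hS : S.Grows) (hS' : S.Desubstitutes) : IsSelfSimilar (wangShift T) :=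
  ⟨{u | IsValid u}, S.apply, fun _ _ ⟨_, _, h⟩ hv => hv.of_factorAt h, isValid_single,
    fun _ ⟨_, hx, _, _, h⟩ => .of_occursAt hx h, fun _ => isValid_apply, S.isMorphismOn,
    hS.isExpansive, hS'.carrier_eq⟩

/-- Compactness: there are valid words of any size, hence a valid tiling of the plane. -/
theorem Grows.tilings_nonempty (hS : S.Grows) (t : T) : (tilings T).Nonempty := by
  -- `K m` is the set of configurations that are validly tiled around the origin up to distance `m`.
  let K : ℕ → Set (ℤ × ℤ → T) := fun m => {x | ∀ n : ℤ × ℤ, |n.1| ≤ m → |n.2| ≤ m →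
    (x n).1.right = (x (n + (1, 0))).1.left ∧ (x n).1.top = (x (n + (0, 1))).1.bottom}
  have hKc : ∀ m, IsClosed (K m) := fun m => by
    have : K m = ⋂ n : ℤ × ℤ, ⋂ _ : |n.1| ≤ m ∧ |n.2| ≤ m,
        (fun x : ℤ × ℤ → T => (x n, x (n + (1, 0)), x (n + (0, 1)))) ⁻¹'
          {p | p.1.1.right = p.2.1.1.left ∧ p.1.1.top = p.2.2.1.bottom} := by
      ext x
      simp [K]
    rw [this]
    exact isClosed_iInter fun n => isClosed_iInter fun _ =>
      IsClosed.preimage (by fun_prop) (isClosed_discrete _)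
  have hK : (⋂ m, K m).Nonempty := by
    refine IsCompact.nonempty_iInter_of_sequence_nonempty_isCompact_isClosed K ?_ ?_ ?_ ?_
    · intro m x hx n h1 h2
      exact hx n (by push_cast; omega) (by push_cast; omega)
    · intro m
      have hu : IsValid (S.apply^[2 * m + 2 + 1] (Word.single t)) :=
        isValid_iterate (isValid_single t) _
      obtain ⟨hw, hh⟩ := hS.lt_iterate (Word.single t) (2 * m + 2)
      set u := S.apply^[2 * m + 2 + 1] (Word.single t)
      refine ⟨fun n => u.get (n.1 + m).toNat (n.2 + m).toNat, fun n h1 h2 => ?_⟩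
      rw [abs_le] at h1 h2
      have e1 : (n.1 + 1 + m).toNat = (n.1 + m).toNat + 1 := by omega
      have e2 : (n.2 + 1 + m).toNat = (n.2 + m).toNat + 1 := by omega
      simp only [Prod.fst_add, Prod.snd_add, add_zero, e1, e2]
      exact ⟨hu.1 _ _ (by omega) (by omega), hu.2 _ _ (by omega) (by omega)⟩
    · exact (hKc 0).isCompact
    · exact hKc
  obtain ⟨x, hx⟩ := hK
  refine ⟨x, fun n => ?_⟩
  refine Set.mem_iInter.1 hx (max |n.1| |n.2|).toNat n ?_ ?_ <;> simp

/-! ### Minimality -/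

/-- Iterated desubstitution: a tiling `z` is cut into the images under the `n`-th power of the
substitution of the tiles of some tiling `x`. -/
theorem Desubstitutes.iterate (hS : S.Desubstitutes) (n : ℕ) {z : ℤ × ℤ → T}
    (hz : z ∈ tilings T) : ∃ x ∈ tilings T, ∃ X Y : ℤ → ℤ, ∀ u : Word T, IsValid u →
      ∀ p q, u.OccursAt x p q → (S.apply^[n] u).OccursAt z (X p) (Y q) ∧
        X (p + u.width) = X p + (S.apply^[n] u).width ∧
        Y (q + u.height) = Y q + (S.apply^[n] u).height := by
  induction n with
  | zero => exact ⟨z, hz, id, id, fun u _ p q h => ⟨h, rfl, rfl⟩⟩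
  | succ n ih =>
    obtain ⟨y, hy, X, Y, h⟩ := ih
    obtain ⟨x, hx, X', Y', h'⟩ := hS y hy
    refine ⟨x, hx, X ∘ X', Y ∘ Y', fun u hu p q hp => ?_⟩
    obtain ⟨h1, h2, h3⟩ := h'.occursAt_apply hu hp
    rw [Function.iterate_succ_apply]
    simp only [Function.comp_apply, h2, h3]
    exact h _ (isValid_apply hu) _ _ h1

/-- The word `v` occurs in the images of all tiles under some power of the substitution. -/
def OccursEverywhere (S : Substitution T) (v : Word T) : Prop :=
  ∃ m, ∀ t : T, v.IsFactor (S.apply^[m] (Word.single t))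

theorem OccursEverywhere.of_isFactor {u v : Word T} (hv : S.OccursEverywhere v)
    (h : u.IsFactor v) : S.OccursEverywhere u :=
  hv.imp fun _ hm t => h.trans (hm t)

theorem OccursEverywhere.iterate {v : Word T} (hv : S.OccursEverywhere v) (n : ℕ) :
    S.OccursEverywhere (S.apply^[n] v) := by
  obtain ⟨m, hm⟩ := hv
  refine ⟨n + m, fun t => ?_⟩
  rw [Function.iterate_add_apply]
  exact isFactor_iterate (isValid_iterate (isValid_single t) m) (hm t) n

/-- If every `2 × 2` word occurring in a tiling occurs everywhere, then every word occurring in a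
tiling `z` does: it lies in the image of a `2 × 2` word under a large power of the substitution. -/
theorem occursEverywhere_of_occursAt (hS : S.Grows) (hS' : S.Desubstitutes)
    (h2 : ∀ x ∈ tilings T, ∀ p q,
      S.OccursEverywhere (Word.window x p q 2 2 Nat.two_pos Nat.two_pos))
    {z : ℤ × ℤ → T} (hz : z ∈ tilings T) {u : Word T} {p q : ℤ} (hu : u.OccursAt z p q) :
    S.OccursEverywhere u := by
  obtain ⟨x, hx, X, Y, h⟩ := hS'.iterate (max u.width u.height + 1) hz
  set N := max u.width u.height with hN
  have hX : ∀ i, X i + N < X (i + 1) := by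
    intro i
    have h1 := (h _ (isValid_single (x (i, 0))) i 0 (Word.occursAt_single rfl)).2.1
    have h3 := (hS.lt_iterate (Word.single (x (i, 0))) N).1
    rw [Word.width_single, Nat.cast_one] at h1
    omega
  have hY : ∀ j, Y j + N < Y (j + 1) := by
    intro j
    have h1 := (h _ (isValid_single (x (0, j))) 0 j (Word.occursAt_single rfl)).2.2
    have h3 := (hS.lt_iterate (Word.single (x (0, j))) N).2
    rw [Word.height_single, Nat.cast_one] at h1
    omega
  obtain ⟨i, hi, hi'⟩ := exists_le_lt_succ (X := X) (fun i => by have := hX i; omega) p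
  obtain ⟨j, hj, hj'⟩ := exists_le_lt_succ (X := Y) (fun j => by have := hY j; omega) q
  have hv := Word.window_occursAt x i j 2 2 Nat.two_pos Nat.two_pos
  have hv2 := h2 x hx i j
  set v := Word.window x i j 2 2 Nat.two_pos Nat.two_pos
  obtain ⟨h3, h4, h5⟩ := h v (.of_occursAt hx hv) i j hv
  have h6 := hX (i + 1)
  have h7 := hY (j + 1)
  have e1 : X (i + v.width) = X (i + 1 + 1) := by rw [add_assoc]; rfl
  have e2 : Y (j + v.height) = Y (j + 1 + 1) := by rw [add_assoc]; rfl
  refine (hv2.iterate (N + 1)).of_isFactor ⟨(p - X i).toNat, (q - Y j).toNat,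
    Word.FactorAt.of_get (by omega) (by omega) fun a ha b hb => ?_⟩
  rw [← h3.get_eq (by omega) (by omega), ← hu.get_eq ha hb]
  congr 2 <;> push_cast <;> omega

theorem isMinimal (hS : S.Grows) (hS' : S.Desubstitutes)
    (h2 : ∀ x ∈ tilings T, ∀ p q,
      S.OccursEverywhere (Word.window x p q 2 2 Nat.two_pos Nat.two_pos)) :
    IsMinimal (wangShift T) := by
  rintro Y ⟨y, hy⟩ hYX
  refine Set.Subset.antisymm hYX fun z hz => ?_
  have key : ∀ N : ℕ, ∃ x ∈ Y.carrier, ∀ n : ℤ × ℤ, |n.1| ≤ N → |n.2| ≤ N → x n = z n := by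
    intro N
    have hu := Word.window_occursAt z (-N) (-N) (2 * N + 1) (2 * N + 1) (by omega) (by omega)
    obtain ⟨m, hm⟩ := occursEverywhere_of_occursAt hS hS' h2 hz hu
    obtain ⟨x, hx, X, Y', h⟩ := hS'.iterate m (hYX hy)
    obtain ⟨i, j, hij⟩ := hm (x (0, 0))
    have h3 := ((h _ (isValid_single (x (0, 0))) 0 0 (Word.occursAt_single rfl)).1).of_factorAt hij
    refine ⟨shift (X 0 + i + N, Y' 0 + j + N) y, Y.mapsTo _ hy, fun n h1 h2 => ?_⟩
    rw [abs_le] at h1 h2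
    have hu' := hu.get_eq (a := (n.1 + N).toNat) (b := (n.2 + N).toNat)
    have h3' := h3.get_eq (a := (n.1 + N).toNat) (b := (n.2 + N).toNat)
    rw [← hu'] at h3'
    · have h4 := h3' ?_ ?_
      · have e1 : ((n.1 + N).toNat : ℤ) = n.1 + N := by omega
        have e2 : ((n.2 + N).toNat : ℤ) = n.2 + N := by omega
        rw [e1, e2] at h4
        convert h4 using 1
        · exact congrArg y (Prod.ext (by simp; ring) (by simp; ring))
        · exact congrArg z (Prod.ext (by simp) (by simp))
      all_goals change (_ : ℕ) < 2 * N + 1; omega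
    all_goals change (_ : ℕ) < 2 * N + 1; omega
  choose x hx hxz using key
  refine Y.isClosed.mem_of_tendsto (f := x) (b := Filter.atTop) (tendsto_pi_nhds.2 fun n => ?_)
    (Filter.Eventually.of_forall hx)
  refine tendsto_const_nhds.congr' ?_
  filter_upwards [Filter.eventually_ge_atTop (max |n.1| |n.2|).toNat] with N hN
  exact (hxz N n (by omega) (by omega)).symm

end Substitution

/-! ### The 19 tiles and their substitution -/

/-- The tiles of `tileSetU`, numbered from `0` to `18`. -/
def tile (i : Fin 19) : tileSetU :=
  ⟨(![⟨.F, .O, .J, .O⟩, ⟨.F, .O, .H, .L⟩, ⟨.J, .M, .F, .P⟩, ⟨.D, .M, .F, .K⟩,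
    ⟨.H, .P, .J, .P⟩, ⟨.H, .P, .H, .N⟩, ⟨.H, .K, .F, .P⟩, ⟨.H, .K, .D, .P⟩,
    ⟨.B, .O, .I, .O⟩, ⟨.G, .L, .E, .O⟩, ⟨.G, .L, .C, .L⟩, ⟨.A, .L, .I, .O⟩,
    ⟨.E, .P, .G, .P⟩, ⟨.E, .P, .I, .P⟩, ⟨.I, .P, .G, .K⟩, ⟨.I, .P, .I, .K⟩,
    ⟨.I, .K, .B, .M⟩, ⟨.I, .K, .A, .K⟩, ⟨.C, .N, .I, .P⟩] : Fin 19 → WangTile VColor HColor) i,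
    by revert i; decide⟩

theorem tile_injective : Function.Injective tile := by
  have h : ∀ i j, tile i = tile j → i = j := by decide +kernel
  exact h

/-- The bijection between the numbers from `0` to `18` and the tiles. -/
noncomputable def tileEquiv : Fin 19 ≃ tileSetU :=
  Equiv.ofBijective tile <| (Fintype.bijective_iff_injective_and_card tile).2
    ⟨tile_injective, by rw [Fintype.card_fin, Fintype.card_coe, card_tileSetU]⟩

/-- The number of a tile. -/
noncomputable def idx (t : tileSetU) : Fin 19 := tileEquiv.symm t

@[simp] theorem idx_tile (i : Fin 19) : idx (tile i) = i := tileEquiv.symm_apply_apply i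

@[simp] theorem tile_idx (t : tileSetU) : tile (idx t) = t := tileEquiv.apply_symm_apply t

/-- The width of the image of a tile with bottom (or top) color `c`. -/
def colorWidth (c : HColor) : ℕ :=
  match c with
  | .L => 1
  | .O => 1
  | _ => 2

/-- The height of the image of a tile with left (or right) color `c`. -/
def colorHeight (c : VColor) : ℕ :=
  match c with
  | .D => 1
  | .F => 1
  | .H => 1
  | .J => 1
  | _ => 2

/-- The width of the image of the `i`-th tile. -/
def wd (i : Fin 19) : ℕ := colorWidth (tile i).1.bottom

/-- The height of the image of the `i`-th tile. -/
def ht (i : Fin 19) : ℕ := colorHeight (tile i).1.left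

/-- Four tiles arranged in a square, in the order lower left, lower right, upper left, upper
right. -/
abbrev Quad := Fin 19 × Fin 19 × Fin 19 × Fin 19

/-- The tile in column `i` and row `j` of a square. -/
def Quad.get (Q : Quad) (i j : ℕ) : Fin 19 :=
  match i, j with
  | 0, 0 => Q.1
  | _ + 1, 0 => Q.2.1
  | 0, _ + 1 => Q.2.2.1
  | _ + 1, _ + 1 => Q.2.2.2

/-- The image of the `i`-th tile. An image of width or height `1` is filled up to a square by
repeating its only column or row. -/
def imgQuad (i : Fin 19) : Quad :=
  (![(17, 17, 17, 17), (16, 16, 16, 16), (15, 11, 15, 11), (13, 9, 13, 9), (17, 8, 17, 8),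
    (16, 8, 16, 8), (15, 8, 15, 8), (14, 8, 14, 8), (14, 14, 6, 6), (17, 17, 3, 3),
    (16, 16, 3, 3), (14, 14, 2, 2), (15, 11, 7, 1), (14, 11, 6, 1), (13, 9, 7, 1),
    (12, 9, 6, 1), (18, 10, 5, 1), (13, 9, 4, 1), (14, 8, 2, 0)] : Fin 19 → Quad) i

theorem wd_eq_one_or_two (i : Fin 19) : wd i = 1 ∨ wd i = 2 := by
  unfold wd colorWidth; split <;> simp

theorem ht_eq_one_or_two (i : Fin 19) : ht i = 1 ∨ ht i = 2 := by
  unfold ht colorHeight; split <;> simp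

theorem imgQuad_inner₁ : ∀ t : Fin 19, ∀ j < 2, wd t = 2 → j < ht t →
    (tile ((imgQuad t).get 0 j)).1.right = (tile ((imgQuad t).get 1 j)).1.left := by
  decide +kernel

theorem imgQuad_inner₂ : ∀ t : Fin 19, ∀ i < 2, i < wd t → ht t = 2 →
    (tile ((imgQuad t).get i 0)).1.top = (tile ((imgQuad t).get i 1)).1.bottom := by
  decide +kernel

theorem imgQuad_outer₁ : ∀ s t : Fin 19, (tile s).1.right = (tile t).1.left → ∀ j < 2, j < ht s →
    (tile ((imgQuad s).get (wd s - 1) j)).1.right = (tile ((imgQuad t).get 0 j)).1.left := by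
  decide +kernel

theorem imgQuad_outer₂ : ∀ s t : Fin 19, (tile s).1.top = (tile t).1.bottom → ∀ i < 2, i < wd s →
    (tile ((imgQuad s).get i (ht s - 1))).1.top = (tile ((imgQuad t).get i 0)).1.bottom := by
  decide +kernel

/-- The self-similarity of the Wang shift of `tileSetU`. -/
noncomputable def omega : Substitution tileSetU where
  width := colorWidth
  height := colorHeight
  img t i j := tile ((imgQuad (idx t)).get i j)
  width_pos c := by cases c <;> decide
  height_pos c := by cases c <;> decide
  width_top t := by
    rw [← tile_idx t]
    generalize idx t = i
    revert i
    decide +kernel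
  height_right t := by
    rw [← tile_idx t]
    generalize idx t = i
    revert i
    decide +kernel
  inner₁ t i j hi hj := by
    rw [← tile_idx t, ← wd] at hi
    rw [← tile_idx t, ← ht] at hj
    obtain rfl : i = 0 := by have := wd_eq_one_or_two (idx t); omega
    exact imgQuad_inner₁ _ j (by have := ht_eq_one_or_two (idx t); omega)
      (by have := wd_eq_one_or_two (idx t); omega) hj
  inner₂ t i j hi hj := by
    rw [← tile_idx t, ← wd] at hi
    rw [← tile_idx t, ← ht] at hj
    obtain rfl : j = 0 := by have := ht_eq_one_or_two (idx t); omega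
    exact imgQuad_inner₂ _ i (by have := wd_eq_one_or_two (idx t); omega) hi
      (by have := ht_eq_one_or_two (idx t); omega)
  outer₁ s t i j hst hi hj := by
    rw [← tile_idx s, ← wd] at hi
    rw [← tile_idx s, ← ht] at hj
    rw [← tile_idx s, ← tile_idx t] at hst
    obtain rfl : i = wd (idx s) - 1 := by omega
    exact imgQuad_outer₁ _ _ hst j (by have := ht_eq_one_or_two (idx s); omega) hj
  outer₂ s t i j hst hi hj := by
    rw [← tile_idx s, ← wd] at hi
    rw [← tile_idx s, ← ht] at hj
    rw [← tile_idx s, ← tile_idx t] at hst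
    obtain rfl : j = ht (idx s) - 1 := by omega
    exact imgQuad_outer₂ _ _ hst i (by have := wd_eq_one_or_two (idx s); omega) hi

theorem omega_width (t : tileSetU) : omega.width t.1.bottom = wd (idx t) := by
  rw [wd, tile_idx]; rfl

theorem omega_height (t : tileSetU) : omega.height t.1.left = ht (idx t) := by
  rw [ht, tile_idx]; rfl

theorem omega_img (t : tileSetU) (i j : ℕ) : omega.img t i j = tile ((imgQuad (idx t)).get i j) :=
  rfl

theorem omega_grows : omega.Grows where
  width t := by
    have h : ∀ t : Fin 19, wd t < cut (fun i => wd ((imgQuad t).get i 0)) (wd t) := by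
      decide +kernel
    simpa only [omega_width, omega_img, idx_tile] using h (idx t)
  height t := by
    have h : ∀ t : Fin 19, ht t < cut (fun j => ht ((imgQuad t).get 0 j)) (ht t) := by
      decide +kernel
    simpa only [omega_height, omega_img, idx_tile] using h (idx t)

/-! ### Pairs of adjacent tiles -/

/-- The tiles whose left color is the right color of `a`. -/
def colorRight (a : Fin 19) : List (Fin 19) :=
  (List.finRange 19).filter fun b => (tile a).1.right = (tile b).1.left

/-- The tiles whose bottom color is the top color of `a`. -/
def colorUp (a : Fin 19) : List (Fin 19) :=
  (List.finRange 19).filter fun b => (tile a).1.top = (tile b).1.bottom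

/-- The tiles that can occur to the right of `a` in a tiling. -/
def toRight (a : Fin 19) : List (Fin 19) :=
  (![[3], [2, 3, 6], [0, 4], [7], [1], [1], [1, 5], [1], [16], [14], [12, 14], [17], [9], [9],
    [8, 11, 13, 18], [8, 11], [8, 13, 15], [8, 13], [10]] : Fin 19 → List (Fin 19)) a

/-- The tiles that can occur on top of `a` in a tiling. -/
def toUp (a : Fin 19) : List (Fin 19) :=
  (![[8], [8, 9, 11], [16], [16], [13], [13], [14, 17], [15], [0, 9, 11], [1, 10], [1], [1, 10],
    [6], [4, 7, 18], [2, 6, 12], [7, 13, 18], [3, 14, 17], [3, 14], [5]] :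
    Fin 19 → List (Fin 19)) a

/-- The horizontal pairs that extend upwards and downwards to valid squares. -/
def toRightAux₁ (a : Fin 19) : List (Fin 19) :=
  if a = 4 then [1, 5] else if a = 7 then [1, 5] else if a = 15 then [8, 11, 13, 18] else toRight a

/-- The vertical pairs that extend to the left and right to squares compatible with
`toRightAux₁`. -/
def toUpAux (a : Fin 19) : List (Fin 19) :=
  if a = 1 then [0, 8, 9, 11] else if a = 6 then [3, 14, 17] else toUp a

/-- The horizontal pairs that extend upwards and downwards to squares compatible with
`toUpAux`. -/
def toRightAux₂ (a : Fin 19) : List (Fin 19) :=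
  if a = 7 then [1, 5] else toRight a

/-- The pair `(a, b)` in one direction extends on both sides to squares whose pairs in this
direction belong to `R` and whose pairs in the other direction belong to `U`. -/
def Extends (R U : Fin 19 → List (Fin 19)) (a b : Fin 19) : Prop :=
  (∃ d ∈ U a, ∃ e ∈ U b, e ∈ R d) ∧ ∃ d, a ∈ U d ∧ ∃ e ∈ R d, b ∈ U e

instance (R U : Fin 19 → List (Fin 19)) (a b : Fin 19) : Decidable (Extends R U a b) :=
  inferInstanceAs (Decidable (_ ∧ _))

/-- If the pairs of `c` in the direction `v` belong to `R` and those in the direction `w` to `U`,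
then only those pairs in the direction `v` occur that extend to squares compatible with `R` and
`U`. -/
theorem mem_of_extends {c : ℤ × ℤ → Fin 19} {R R' U : Fin 19 → List (Fin 19)} {v w : ℤ × ℤ}
    (hR : ∀ n, c (n + v) ∈ R (c n)) (hU : ∀ n, c (n + w) ∈ U (c n))
    (h : ∀ a, ∀ b ∈ R a, Extends R U a b → b ∈ R' a) (n : ℤ × ℤ) : c (n + v) ∈ R' (c n) := by
  refine h _ _ (hR n) ⟨⟨_, hU n, _, hU _, ?_⟩, c (n - w), ?_, _, hR _, ?_⟩
  · have := hR (n + w)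
    rwa [add_right_comm] at this
  · simpa only [sub_add_cancel] using hU (n - w)
  · have := hU (n - w + v)
    rwa [add_right_comm, sub_add_cancel] at this

/-- The pairs of adjacent tiles in a tiling belong to `toRight` and `toUp`. -/
theorem idx_mem_toRight_toUp {z : ℤ × ℤ → tileSetU} (hz : z ∈ tilings tileSetU) :
    (∀ n, idx (z (n + (1, 0))) ∈ toRight (idx (z n))) ∧
      ∀ n, idx (z (n + (0, 1))) ∈ toUp (idx (z n)) := by
  have hR₀ : ∀ n, idx (z (n + (1, 0))) ∈ colorRight (idx (z n)) := fun n => by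
    simpa [colorRight] using (hz n).1
  have hU₀ : ∀ n, idx (z (n + (0, 1))) ∈ colorUp (idx (z n)) := fun n => by
    simpa [colorUp] using (hz n).2
  have hR₁ := mem_of_extends (c := idx ∘ z) (R' := toRightAux₁) hR₀ hU₀ (by decide +kernel)
  have hU₁ := mem_of_extends (c := idx ∘ z) (R' := toUpAux) hU₀ hR₁ (by decide +kernel)
  have hR₂ := mem_of_extends (c := idx ∘ z) (R' := toRightAux₂) hR₁ hU₁ (by decide +kernel)
  have hU₂ := mem_of_extends (c := idx ∘ z) (R' := toUp) hU₁ hR₂ (by decide +kernel)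
  exact ⟨mem_of_extends (c := idx ∘ z) (R' := toRight) hR₂ hU₂ (by decide +kernel), hU₂⟩

/-! ### Wide columns and high rows -/

theorem eq_of_forall_succ_eq {α : Type*} {f : ℤ → α} (h : ∀ n, f (n + 1) = f n) (n : ℤ) :
    f n = f 0 := by
  induction n with
  | zero => rfl
  | succ n ih => rw [h, ih]
  | pred n ih => rw [← h, sub_add_cancel, ih]

theorem wd_eq_of_mem_toUp : ∀ a, ∀ b ∈ toUp a, wd b = wd a := by decide +kernel

theorem ht_eq_of_mem_toRight : ∀ a, ∀ b ∈ toRight a, ht b = ht a := by decide +kernel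

theorem wd_of_mem_toRight : ∀ a, ∀ b ∈ toRight a, wd a = 2 ∨ wd b = 2 := by decide +kernel

theorem ht_of_mem_toUp : ∀ a, ∀ b ∈ toUp a, ht a = 2 ∨ ht b = 2 := by decide +kernel

theorem mem_toRight {z : ℤ × ℤ → tileSetU} (hz : z ∈ tilings tileSetU) (p q : ℤ) :
    idx (z (p + 1, q)) ∈ toRight (idx (z (p, q))) := by
  simpa using (idx_mem_toRight_toUp hz).1 (p, q)

theorem mem_toUp {z : ℤ × ℤ → tileSetU} (hz : z ∈ tilings tileSetU) (p q : ℤ) :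
    idx (z (p, q + 1)) ∈ toUp (idx (z (p, q))) := by
  simpa using (idx_mem_toRight_toUp hz).2 (p, q)

theorem wd_column {z : ℤ × ℤ → tileSetU} (hz : z ∈ tilings tileSetU) (p q : ℤ) :
    wd (idx (z (p, q))) = wd (idx (z (p, 0))) :=
  eq_of_forall_succ_eq (f := fun q => wd (idx (z (p, q))))
    (fun _ => wd_eq_of_mem_toUp _ _ (mem_toUp hz _ _)) q

theorem ht_row {z : ℤ × ℤ → tileSetU} (hz : z ∈ tilings tileSetU) (p q : ℤ) :
    ht (idx (z (p, q))) = ht (idx (z (0, q))) :=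
  eq_of_forall_succ_eq (f := fun p => ht (idx (z (p, q))))
    (fun _ => ht_eq_of_mem_toRight _ _ (mem_toRight hz _ _)) p

/-- If no two consecutive terms of a sequence of `1`s and `2`s are `1`, then the positions of the
`2`s form a two-sided sequence with gaps `1` and `2`. -/
theorem exists_enumeration {c : ℤ → ℕ} (h1 : ∀ n, c n = 1 ∨ c n = 2)
    (h2 : ∀ n, c n = 2 ∨ c (n + 1) = 2) : ∃ X : ℤ → ℤ, ∀ i, c (X i) = 2 ∧
      X (i + 1) = X i + (if c (X i + 1) = 1 then 2 else 1 : ℕ) := by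
  -- The map to the next `2` is a permutation of the positions of the `2`s; `X` is an orbit of it.
  let e : Equiv.Perm {n // c n = 2} :=
    { toFun := fun n => ⟨n.1 + (if c (n.1 + 1) = 1 then 2 else 1 : ℕ), by
        have := h1 (n.1 + 1)
        have := h2 (n.1 + 1)
        split_ifs with h
        · rw [add_assoc] at this; simp_all
        · simp_all⟩
      invFun := fun n => ⟨n.1 - (if c (n.1 - 1) = 1 then 2 else 1 : ℕ), by
        have := h1 (n.1 - 1)
        have := h2 (n.1 - 2)
        have e : n.1 - 2 + 1 = n.1 - 1 := by ring
        rw [e] at this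
        split_ifs with h
        · simp_all
        · simp_all⟩
      left_inv := by
        rintro ⟨n, hn⟩
        ext
        have e : n + 2 - 1 = n + 1 := by ring
        by_cases h : c (n + 1) = 1 <;> simp [h, e, hn]
      right_inv := by
        rintro ⟨n, hn⟩
        ext
        have e : n - 2 + 1 = n - 1 := by ring
        by_cases h : c (n - 1) = 1 <;> simp [h, e, hn] }
  obtain ⟨n₀⟩ : Nonempty {n // c n = 2} := (h2 0).elim (fun h => ⟨0, h⟩) fun h => ⟨0 + 1, h⟩
  refine ⟨fun i => ((e ^ i) n₀).1, fun i => ⟨((e ^ i) n₀).2, ?_⟩⟩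
  simp only [add_comm i 1, zpow_add, zpow_one, Equiv.Perm.mul_apply]
  rfl

/-! ### Desubstitution -/

/-- A square whose lower left tile is wide and high contains the image of a tile, whose shape can be
read off from the widths and heights of its tiles. -/
theorem exists_imgQuad : ∀ a, wd a = 2 → ht a = 2 → ∀ b ∈ toRight a, ∀ d ∈ toUp a,
    ∀ e ∈ toRight d, e ∈ toUp b →
    ∃ t, wd t = (if wd b = 1 then 2 else 1) ∧ ht t = (if ht d = 1 then 2 else 1) ∧
      ∀ i < 2, ∀ j < 2, i < wd t → j < ht t → (imgQuad t).get i j = Quad.get (a, b, d, e) i j := by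
  decide +kernel

/-- The colors of an edge of the image of a tile determine the color of the edge of the tile. -/
theorem right_eq_left_of_imgQuad : ∀ s t, ht s = ht t → (∀ j < 2, j < ht s →
    (tile ((imgQuad s).get (wd s - 1) j)).1.right = (tile ((imgQuad t).get 0 j)).1.left) →
    (tile s).1.right = (tile t).1.left := by
  decide +kernel

theorem top_eq_bottom_of_imgQuad : ∀ s t, wd s = wd t → (∀ i < 2, i < wd s →
    (tile ((imgQuad s).get i (ht s - 1))).1.top = (tile ((imgQuad t).get i 0)).1.bottom) →
    (tile s).1.top = (tile t).1.bottom := by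
  decide +kernel

theorem omega_desubstitutes : omega.Desubstitutes := by
  intro z hz
  obtain ⟨X, hX⟩ := exists_enumeration (c := fun p => wd (idx (z (p, 0))))
    (fun _ => wd_eq_one_or_two _) (fun p => wd_of_mem_toRight _ _ (mem_toRight hz p 0))
  obtain ⟨Y, hY⟩ := exists_enumeration (c := fun q => ht (idx (z (0, q))))
    (fun _ => ht_eq_one_or_two _) (fun q => ht_of_mem_toUp _ _ (mem_toUp hz 0 q))
  have key : ∀ i j, ∃ t, X (i + 1) = X i + wd t ∧ Y (j + 1) = Y j + ht t ∧
      ∀ a b : ℕ, a < wd t → b < ht t → z (X i + a, Y j + b) = tile ((imgQuad t).get a b) := by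
    intro i j
    obtain ⟨t, h1, h2, h3⟩ := exists_imgQuad (idx (z (X i, Y j)))
      (by rw [wd_column hz]; exact (hX i).1) (by rw [ht_row hz]; exact (hY j).1)
      _ (mem_toRight hz _ _) _ (mem_toUp hz _ _) _ (mem_toRight hz _ _) (mem_toUp hz _ _)
    rw [wd_column hz] at h1
    rw [ht_row hz] at h2
    refine ⟨t, by rw [h1]; exact (hX i).2, by rw [h2]; exact (hY j).2, fun a b ha hb => ?_⟩
    have ha' : a < 2 := by have := wd_eq_one_or_two t; omega
    have hb' : b < 2 := by have := ht_eq_one_or_two t; omega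
    rw [h3 a ha' b hb' ha hb]
    interval_cases a <;> interval_cases b <;> simp [Quad.get]
  choose t h1 h2 h3 using key
  refine ⟨fun n => tile (t n.1 n.2), ?_, X, Y, ?_, ?_, ?_⟩
  · rintro ⟨i, j⟩
    have hwd : wd (t i j) = wd (t i (j + 1)) := by have := h1 i j; have := h1 i (j + 1); omega
    have hht : ht (t i j) = ht (t (i + 1) j) := by have := h2 i j; have := h2 (i + 1) j; omega
    have hw := wd_eq_one_or_two (t i j)
    have hh := ht_eq_one_or_two (t i j)
    simp only [Prod.mk_add_mk, add_zero]
    constructor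
    · refine right_eq_left_of_imgQuad _ _ hht fun b _ hb => ?_
      rw [← h3 i j _ _ (by omega) hb,
        ← h3 (i + 1) j 0 b (by have := wd_eq_one_or_two (t (i + 1) j); omega) (by omega),
        h1 i j, (hz _).1]
      congr 4
      ext
      · simp only [Prod.mk_add_mk]; omega
      · simp
    · refine top_eq_bottom_of_imgQuad _ _ hwd fun a _ ha => ?_
      rw [← h3 i j _ _ ha (by omega), ← h3 i (j + 1) a 0 (by omega)
        (by have := ht_eq_one_or_two (t i (j + 1)); omega), h2 i j, (hz _).2]
      congr 4
      ext
      · simp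
      · simp only [Prod.mk_add_mk]; omega
  · simpa [omega_width] using h1
  · intro i j
    simpa [omega_height] using h2 i j
  · intro i j a b ha hb
    rw [omega_width, idx_tile] at ha
    rw [omega_height, idx_tile] at hb
    rw [h3 i j a b ha hb, omega_img, idx_tile]

/-! ### Aperiodicity -/

theorem imgQuad_wd : ∀ t, ∀ j < 2, j < ht t →
    wd ((imgQuad t).get 0 j) = 2 ∧ (wd t = 2 → wd ((imgQuad t).get 1 j) = 1) := by
  decide +kernel

theorem imgQuad_ht : ∀ t, ∀ i < 2, i < wd t →
    ht ((imgQuad t).get i 0) = 2 ∧ (ht t = 2 → ht ((imgQuad t).get i 1) = 1) := by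
  decide +kernel

theorem imgQuad_injective : ∀ s t, wd s = wd t → ht s = ht t →
    (∀ i < 2, ∀ j < 2, i < wd s → j < ht s → (imgQuad s).get i j = (imgQuad t).get i j) →
    s = t := by
  decide +kernel

section Recognizability

variable {x z : ℤ × ℤ → tileSetU} {X Y : ℤ → ℤ}

theorem idx_of_isCutImage (h : omega.IsCutImage x z X Y) (i j : ℤ) {a b : ℕ}
    (ha : a < wd (idx (x (i, j)))) (hb : b < ht (idx (x (i, j)))) :
    idx (z (X i + a, Y j + b)) = (imgQuad (idx (x (i, j)))).get a b := by
  rw [h.img i j a b (by rwa [omega_width]) (by rwa [omega_height]), omega_img, idx_tile]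

/-- The vertical cuts can be read off from the image: they are on the left of the wide columns. -/
theorem wd_eq_two_iff (h : omega.IsCutImage x z X Y) (hz : z ∈ tilings tileSetU) (p : ℤ) :
    wd (idx (z (p, 0))) = 2 ↔ ∃ i, X i = p := by
  constructor
  · intro hp
    obtain ⟨i, j, a, b, ha, hb, rfl, -⟩ := h.exists_eq_add p 0
    rw [omega_width] at ha
    rw [omega_height] at hb
    rw [← wd_column hz _ (Y j + b), idx_of_isCutImage h i j ha hb] at hp
    have h1 := wd_eq_one_or_two (idx (x (i, j)))
    have h2 := ht_eq_one_or_two (idx (x (i, j)))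
    rcases Nat.eq_zero_or_pos a with rfl | ha'
    · exact ⟨i, by simp⟩
    · obtain rfl : a = 1 := by omega
      rw [(imgQuad_wd _ b (by omega) hb).2 (by omega)] at hp
      omega
  · rintro ⟨i, rfl⟩
    have h1 := wd_eq_one_or_two (idx (x (i, 0)))
    have h2 := ht_eq_one_or_two (idx (x (i, 0)))
    have := idx_of_isCutImage h i 0 (a := 0) (b := 0) (by omega) (by omega)
    rw [Nat.cast_zero, add_zero, add_zero] at this
    rw [← wd_column hz _ (Y 0), this]
    exact (imgQuad_wd _ 0 (by omega) (by omega)).1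

/-- The horizontal cuts can be read off from the image: they are below the high rows. -/
theorem ht_eq_two_iff (h : omega.IsCutImage x z X Y) (hz : z ∈ tilings tileSetU) (q : ℤ) :
    ht (idx (z (0, q))) = 2 ↔ ∃ j, Y j = q := by
  constructor
  · intro hp
    obtain ⟨i, j, a, b, ha, hb, -, rfl⟩ := h.exists_eq_add 0 q
    rw [omega_width] at ha
    rw [omega_height] at hb
    rw [← ht_row hz (X i + a), idx_of_isCutImage h i j ha hb] at hp
    have h1 := wd_eq_one_or_two (idx (x (i, j)))
    have h2 := ht_eq_one_or_two (idx (x (i, j)))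
    rcases Nat.eq_zero_or_pos b with rfl | hb'
    · exact ⟨j, by simp⟩
    · obtain rfl : b = 1 := by omega
      rw [(imgQuad_ht _ a (by omega) ha).2 (by omega)] at hp
      omega
  · rintro ⟨j, rfl⟩
    have h1 := wd_eq_one_or_two (idx (x (0, j)))
    have h2 := ht_eq_one_or_two (idx (x (0, j)))
    have := idx_of_isCutImage h 0 j (a := 0) (b := 0) (by omega) (by omega)
    rw [Nat.cast_zero, add_zero, add_zero] at this
    rw [← ht_row hz (X 0), this]
    exact (imgQuad_ht _ 0 (by omega) (by omega)).1

/-- There are no two consecutive pieces of length `1`. -/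
theorem add_three_le₁ (h : omega.IsCutImage x z X Y) (hx : x ∈ tilings tileSetU) (i : ℤ) :
    X i + 3 ≤ X (i + 1 + 1) := by
  have h1 := h.width i 0
  have h2 := h.width (i + 1) 0
  rw [omega_width] at h1 h2
  have h3 := wd_eq_one_or_two (idx (x (i, 0)))
  have h4 := wd_eq_one_or_two (idx (x (i + 1, 0)))
  have h5 := wd_of_mem_toRight _ _ (mem_toRight hx i 0)
  omega

theorem add_three_le₂ (h : omega.IsCutImage x z X Y) (hx : x ∈ tilings tileSetU) (j : ℤ) :
    Y j + 3 ≤ Y (j + 1 + 1) := by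
  have h1 := h.height 0 j
  have h2 := h.height 0 (j + 1)
  rw [omega_height] at h1 h2
  have h3 := ht_eq_one_or_two (idx (x (0, j)))
  have h4 := ht_eq_one_or_two (idx (x (0, j + 1)))
  have h5 := ht_of_mem_toUp _ _ (mem_toUp hx 0 j)
  omega

end Recognizability

/-- If the range of a strictly increasing sequence has the period `p`, then so has the sequence, up
to a shift of its indices. -/
theorem exists_index_period {X : ℤ → ℤ} (hX : ∀ i, X i < X (i + 1)) {p : ℤ}
    (h : ∀ i, ∃ j, X j = X i + p) (h' : ∀ i, ∃ j, X j = X i - p) :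
    ∃ r, ∀ i, X (i + r) = X i + p := by
  have hm : StrictMono X := strictMono_int_of_lt_succ hX
  obtain ⟨r, hr⟩ := h 0
  refine ⟨r, fun i => ?_⟩
  induction i with
  | zero => rwa [zero_add]
  | succ i ih =>
    obtain ⟨k, hk⟩ := h (i + 1)
    obtain ⟨l, hl⟩ := h' (i + 1 + r)
    have e : (i : ℤ) + 1 + r = i + r + 1 := by ring
    have h1 := hX i
    have h2 := hX (i + r)
    rw [e] at hl ⊢
    have h3 : (i : ℤ) + r < k := hm.lt_iff_lt.1 (by omega)
    have h4 : (i : ℤ) < l := hm.lt_iff_lt.1 (by omega)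
    have h5 := hm.le_iff_le.2 (Int.add_one_le_of_lt h3)
    have h6 := hm.le_iff_le.2 (Int.add_one_le_of_lt h4)
    omega
  | pred i ih =>
    obtain ⟨k, hk⟩ := h (-i - 1)
    obtain ⟨l, hl⟩ := h' (-i - 1 + r)
    have e : -(i : ℤ) - 1 + r = -i + r - 1 := by ring
    have h1 := hX (-i - 1)
    have h2 := hX (-i + r - 1)
    rw [sub_add_cancel] at h1 h2
    rw [e] at hl ⊢
    have h3 : k < -(i : ℤ) + r := hm.lt_iff_lt.1 (by omega)
    have h4 : l < -(i : ℤ) := hm.lt_iff_lt.1 (by omega)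
    have h5 := hm.le_iff_le.2 (Int.le_sub_one_of_lt h3)
    have h6 := hm.le_iff_le.2 (Int.le_sub_one_of_lt h4)
    omega

theorem three_mul_abs_le {X : ℤ → ℤ} (hX : ∀ i, X i + 3 ≤ X (i + 1 + 1)) {p r : ℤ}
    (h : ∀ i, X (i + r) = X i + p) : 3 * |r| ≤ 2 * |p| := by
  have key : ∀ (k : ℕ) (i : ℤ), X i + 3 * k ≤ X (i + 2 * k) := by
    intro k i
    induction k with
    | zero => simp
    | succ k ih =>
      have := hX (i + 2 * k)
      have e : i + 2 * ((k + 1 : ℕ) : ℤ) = i + 2 * k + 1 + 1 := by push_cast; ring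
      rw [e]
      push_cast
      omega
  have h2 : X (2 * r) = X 0 + 2 * p := by
    have := h 0
    rw [zero_add] at this
    rw [two_mul, h, this]
    ring
  rcases le_total 0 r with hr | hr
  · have := key r.toNat 0
    rw [Int.toNat_of_nonneg hr, zero_add, h2] at this
    have := le_abs_self p
    rw [abs_of_nonneg hr]
    omega
  · have := key (-r).toNat (2 * r)
    have e : 2 * r + 2 * -r = 0 := by ring
    rw [Int.toNat_of_nonneg (by omega), e, h2] at this
    have := neg_abs_le p
    rw [abs_of_nonpos hr]
    omega

/-- Tilings have no nonzero periods, by descent: a period of a tiling induces a smaller period of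
its desubstitution. -/
theorem period_eq_zero (N : ℕ) : ∀ z ∈ tilings tileSetU, ∀ p q : ℤ, |p| + |q| ≤ N →
    (∀ m n, z (m + p, n + q) = z (m, n)) → p = 0 ∧ q = 0 := by
  induction N with
  | zero =>
    intro z _ p q hN _
    have := abs_nonneg p
    have := abs_nonneg q
    exact ⟨abs_eq_zero.1 (by push_cast at hN; omega), abs_eq_zero.1 (by push_cast at hN; omega)⟩
  | succ N ih =>
    intro z hz p q hN hpq
    obtain ⟨x, hx, X, Y, h⟩ := omega_desubstitutes z hz
    have hc : ∀ m, wd (idx (z (m + p, 0))) = wd (idx (z (m, 0))) := fun m => by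
      rw [← wd_column hz _ (0 + q), hpq]
    have hq : ∀ n, ht (idx (z (0, n + q))) = ht (idx (z (0, n))) := fun n => by
      rw [← ht_row hz (0 + p), hpq]
    obtain ⟨r, hr⟩ := exists_index_period h.lt_succ₁ (p := p)
      (fun i => (wd_eq_two_iff h hz _).1 (by rw [hc]; exact (wd_eq_two_iff h hz _).2 ⟨i, rfl⟩))
      (fun i => (wd_eq_two_iff h hz _).1 (by
        rw [← hc, sub_add_cancel]; exact (wd_eq_two_iff h hz _).2 ⟨i, rfl⟩))
    obtain ⟨s, hs⟩ := exists_index_period h.lt_succ₂ (p := q)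
      (fun j => (ht_eq_two_iff h hz _).1 (by
        rw [hq]; exact (ht_eq_two_iff h hz _).2 ⟨j, rfl⟩))
      (fun j => (ht_eq_two_iff h hz _).1 (by
        rw [← hq, sub_add_cancel]; exact (ht_eq_two_iff h hz _).2 ⟨j, rfl⟩))
    have h1 := three_mul_abs_le (add_three_le₁ h hx) hr
    have h2 := three_mul_abs_le (add_three_le₂ h hx) hs
    have hx' : ∀ i j, x (i + r, j + s) = x (i, j) := by
      intro i j
      have hw : wd (idx (x (i + r, j + s))) = wd (idx (x (i, j))) := by
        have e1 := h.width (i + r) (j + s)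
        have e2 := h.width i j
        have e3 := hr (i + 1)
        rw [add_right_comm] at e3
        rw [omega_width] at e1 e2
        have := hr i
        omega
      have hh : ht (idx (x (i + r, j + s))) = ht (idx (x (i, j))) := by
        have e1 := h.height (i + r) (j + s)
        have e2 := h.height i j
        have e3 := hs (j + 1)
        rw [add_right_comm] at e3
        rw [omega_height] at e1 e2
        have := hs j
        omega
      have hi : idx (x (i + r, j + s)) = idx (x (i, j)) := by
        refine imgQuad_injective _ _ hw hh fun a _ b _ ha hb => ?_
        rw [← idx_of_isCutImage h _ _ ha hb, ← idx_of_isCutImage h i j (by omega) (by omega), hr,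
          hs, add_right_comm, add_right_comm (Y j), hpq]
      rw [← tile_idx (x (i, j)), ← hi, tile_idx]
    have hrs : r = 0 ∧ s = 0 := by
      by_cases hpos : 0 < |p| + |q|
      · exact ih x hx r s (by push_cast at hN; omega) hx'
      · have := abs_nonneg r
        have := abs_nonneg s
        exact ⟨abs_eq_zero.1 (by omega), abs_eq_zero.1 (by omega)⟩
    obtain ⟨rfl, rfl⟩ := hrs
    have e1 := hr 0
    have e2 := hs 0
    rw [add_zero] at e1 e2
    exact ⟨by omega, by omega⟩

theorem isAperiodic_tileSetU : IsAperiodic (wangShift tileSetU) := by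
  refine ⟨omega_grows.tilings_nonempty (tile 0), fun z hz n hn h => hn ?_⟩
  have := period_eq_zero (|n.1| + |n.2|).toNat z hz n.1 n.2 (by
    have := abs_nonneg n.1
    have := abs_nonneg n.2
    omega) fun a b => by
      have := congrFun h (a, b)
      rw [← this]
      exact congrArg z (Prod.ext (add_comm _ _) (add_comm _ _))
  exact Prod.ext this.1 this.2

/-! ### Minimality of the Wang shift of `tileSetU` -/

/-- The `2 × 2` word with the tiles of a square. -/
def block (Q : Quad) : Word tileSetU :=
  Word.ofFun 2 2 Nat.two_pos Nat.two_pos fun i j => tile (Q.get i j)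

theorem get_block (Q : Quad) {i j : ℕ} (hi : i < 2) (hj : j < 2) :
    (block Q).get i j = tile (Q.get i j) :=
  (Word.at_iff.1 (Word.ofFun_at.2 ⟨hi, hj, rfl⟩)).2.2

/-- The tile at the position `(p, q)` of the image of a square. -/
def expand (Q : Quad) (p q : ℕ) : Fin 19 :=
  (imgQuad (Q.get (if p < wd (Q.get 0 0) then 0 else 1) (if q < ht (Q.get 0 0) then 0 else 1))).get
    (if p < wd (Q.get 0 0) then p else p - wd (Q.get 0 0))
    (if q < ht (Q.get 0 0) then q else q - ht (Q.get 0 0))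

/-- The square at the position `(p, q)` of the image of a square. -/
def subQuad (Q : Quad) (p q : ℕ) : Quad :=
  (expand Q p q, expand Q (p + 1) q, expand Q p (q + 1), expand Q (p + 1) (q + 1))

theorem colWidth_block (Q : Quad) {i : ℕ} (hi : i < 2) :
    omega.colWidth (block Q) i = wd (Q.get i 0) := by
  rw [Substitution.colWidth, get_block Q hi Nat.two_pos, omega_width, idx_tile]

theorem rowHeight_block (Q : Quad) {j : ℕ} (hj : j < 2) :
    omega.rowHeight (block Q) j = ht (Q.get 0 j) := by
  rw [Substitution.rowHeight, get_block Q Nat.two_pos hj, omega_height, idx_tile]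

theorem width_apply_block (Q : Quad) :
    (omega.apply (block Q)).width = wd (Q.get 0 0) + wd (Q.get 1 0) := by
  rw [← colWidth_block Q Nat.two_pos, ← colWidth_block Q Nat.one_lt_two]
  exact Finset.sum_range_succ _ 1 |>.trans (by simp)

theorem height_apply_block (Q : Quad) :
    (omega.apply (block Q)).height = ht (Q.get 0 0) + ht (Q.get 0 1) := by
  rw [← rowHeight_block Q Nat.two_pos, ← rowHeight_block Q Nat.one_lt_two]
  exact Finset.sum_range_succ _ 1 |>.trans (by simp)

theorem get_apply_block (Q : Quad) {p q : ℕ} (hp : p < wd (Q.get 0 0) + wd (Q.get 1 0))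
    (hq : q < ht (Q.get 0 0) + ht (Q.get 0 1)) :
    (omega.apply (block Q)).get p q = tile (expand Q p q) := by
  have e1 : p = cut (omega.colWidth (block Q)) (if p < wd (Q.get 0 0) then 0 else 1) +
      (if p < wd (Q.get 0 0) then p else p - wd (Q.get 0 0)) := by
    have := colWidth_block Q Nat.two_pos
    split_ifs
    · simp
    · rw [cut_succ, cut_zero]; omega
  have e2 : q = cut (omega.rowHeight (block Q)) (if q < ht (Q.get 0 0) then 0 else 1) +
      (if q < ht (Q.get 0 0) then q else q - ht (Q.get 0 0)) := by
    have := rowHeight_block Q Nat.two_pos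
    split_ifs
    · simp
    · rw [cut_succ, cut_zero]; omega
  have hi : (if p < wd (Q.get 0 0) then 0 else 1) < 2 := by split_ifs <;> omega
  have hj : (if q < ht (Q.get 0 0) then 0 else 1) < 2 := by split_ifs <;> omega
  conv_lhs => rw [e1, e2]
  rw [omega.get_apply (block Q) hi hj, get_block Q hi hj, omega_img, idx_tile]
  · rfl
  · rw [colWidth_block Q hi]; split_ifs <;> omega
  · rw [rowHeight_block Q hj]; split_ifs <;> omega

/-- A square, the square in whose image it occurs, and the position where it occurs. -/
structure Descent where
  child : Quad
  parent : Quad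
  col : ℕ
  row : ℕ

/-- The square `d.child` occurs in the image of `d.parent` at the position `(d.col, d.row)`. -/
def Descent.IsCorrect (d : Descent) : Prop :=
  d.col + 1 < wd (d.parent.get 0 0) + wd (d.parent.get 1 0) ∧
    d.row + 1 < ht (d.parent.get 0 0) + ht (d.parent.get 0 1) ∧
    subQuad d.parent d.col d.row = d.child

instance (d : Descent) : Decidable d.IsCorrect := inferInstanceAs (Decidable (_ ∧ _))

/-- Every entry of the list is correct, and its parent is `Q₀` or the child of a later entry. -/
def IsGenealogy (Q₀ : Quad) : List Descent → Prop
  | [] => True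
  | d :: l => d.IsCorrect ∧ (d.parent = Q₀ ∨ d.parent ∈ l.map Descent.child) ∧ IsGenealogy Q₀ l

instance (Q₀ : Quad) : (l : List Descent) → Decidable (IsGenealogy Q₀ l)
  | [] => inferInstanceAs (Decidable True)
  | _ :: l =>
    have := instDecidableIsGenealogy Q₀ l
    inferInstanceAs (Decidable (_ ∧ _))

theorem Descent.IsCorrect.occursEverywhere {d : Descent} (hd : d.IsCorrect)
    (h : omega.OccursEverywhere (block d.parent)) : omega.OccursEverywhere (block d.child) := by
  obtain ⟨h1, h2, h3⟩ := hd
  refine (h.iterate 1).of_isFactor ⟨d.col, d.row, Word.FactorAt.of_get ?_ ?_ fun a ha b hb => ?_⟩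
  · exact (width_apply_block d.parent).symm ▸ h1
  · exact (height_apply_block d.parent).symm ▸ h2
  · change a < 2 at ha
    change b < 2 at hb
    rw [Function.iterate_one, get_apply_block _ (by omega) (by omega), get_block _ ha hb, ← h3]
    interval_cases a <;> interval_cases b <;> rfl

theorem IsGenealogy.occursEverywhere {Q₀ : Quad} (h₀ : omega.OccursEverywhere (block Q₀))
    {l : List Descent} (hl : IsGenealogy Q₀ l) :
    ∀ Q ∈ l.map Descent.child, omega.OccursEverywhere (block Q) := by
  induction l with
  | nil => simp
  | cons d l ih =>
    obtain ⟨h1, h2, h3⟩ := hl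
    intro Q hQ
    rw [List.map_cons, List.mem_cons] at hQ
    rcases hQ with rfl | hQ
    · exact h1.occursEverywhere (h2.elim (fun e => e ▸ h₀) (ih h3 _))
    · exact ih h3 Q hQ

/-- The squares that occur in tilings, except for the image of the tile `14`, with an occurrence of
each of them in the image of another one. -/
def genealogy : List Descent :=
   [⟨(16, 15, 3, 7), (9, 14, 10, 12), 0, 2⟩, ⟨(17, 13, 14, 18), (0, 3, 8, 16), 0, 0⟩,
    ⟨(16, 15, 17, 13), (1, 6, 9, 14), 0, 0⟩, ⟨(6, 5, 14, 13), (8, 16, 11, 17), 0, 1⟩,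
    ⟨(16, 13, 3, 7), (11, 17, 10, 14), 0, 2⟩, ⟨(16, 8, 14, 11), (6, 5, 17, 13), 2, 0⟩,
    ⟨(16, 15, 14, 13), (1, 6, 11, 17), 0, 0⟩, ⟨(10, 12, 1, 6), (3, 7, 16, 15), 1, 1⟩,
    ⟨(9, 14, 10, 12), (3, 7, 16, 15), 1, 0⟩, ⟨(15, 11, 7, 1), (14, 8, 12, 9), 0, 2⟩,
    ⟨(0, 3, 8, 16), (18, 10, 5, 1), 1, 1⟩, ⟨(8, 16, 0, 3), (13, 9, 18, 10), 1, 2⟩,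
    ⟨(2, 0, 16, 8), (14, 18, 6, 5), 2, 1⟩, ⟨(14, 8, 2, 0), (16, 13, 14, 18), 2, 2⟩,
    ⟨(1, 6, 9, 14), (16, 13, 14, 18), 1, 1⟩, ⟨(8, 16, 11, 17), (4, 1, 13, 9), 1, 0⟩,
    ⟨(17, 8, 14, 11), (2, 4, 16, 13), 2, 0⟩, ⟨(10, 14, 1, 6), (2, 4, 16, 13), 1, 1⟩,
    ⟨(11, 17, 10, 14), (2, 4, 16, 13), 1, 0⟩, ⟨(6, 1, 17, 8), (14, 13, 2, 4), 2, 1⟩,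
    ⟨(5, 1, 13, 9), (8, 16, 9, 14), 1, 1⟩, ⟨(6, 5, 17, 13), (8, 16, 9, 14), 0, 1⟩,
    ⟨(1, 6, 11, 17), (15, 8, 13, 9), 1, 1⟩, ⟨(6, 1, 14, 11), (15, 8, 13, 9), 0, 1⟩,
    ⟨(15, 11, 18, 10), (1, 2, 8, 16), 1, 0⟩, ⟨(16, 15, 14, 18), (1, 2, 8, 16), 0, 0⟩,
    ⟨(7, 1, 15, 11), (9, 14, 1, 2), 1, 1⟩, ⟨(3, 7, 16, 15), (9, 14, 1, 2), 0, 1⟩,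
    ⟨(17, 13, 3, 7), (9, 14, 1, 2), 0, 0⟩, ⟨(12, 9, 6, 1), (7, 1, 15, 8), 0, 1⟩,
    ⟨(14, 8, 12, 9), (7, 1, 15, 8), 0, 0⟩, ⟨(18, 10, 5, 1), (1, 3, 8, 16), 1, 1⟩,
    ⟨(13, 9, 18, 10), (1, 3, 8, 16), 1, 0⟩, ⟨(14, 18, 6, 5), (1, 3, 8, 16), 0, 1⟩,
    ⟨(16, 13, 14, 18), (1, 3, 8, 16), 0, 0⟩, ⟨(4, 1, 13, 9), (11, 17, 1, 3), 1, 1⟩,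
    ⟨(13, 9, 4, 1), (11, 17, 1, 3), 1, 0⟩, ⟨(2, 4, 16, 13), (11, 17, 1, 3), 0, 1⟩,
    ⟨(14, 13, 2, 4), (11, 17, 1, 3), 0, 0⟩, ⟨(9, 14, 1, 6), (6, 1, 14, 8), 1, 1⟩,
    ⟨(8, 16, 9, 14), (6, 1, 14, 8), 1, 0⟩, ⟨(15, 8, 13, 9), (6, 1, 14, 8), 0, 0⟩,
    ⟨(1, 2, 8, 16), (14, 11, 6, 1), 1, 1⟩, ⟨(9, 14, 1, 2), (14, 11, 6, 1), 1, 0⟩,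
    ⟨(7, 1, 15, 8), (14, 11, 6, 1), 0, 1⟩, ⟨(1, 3, 8, 16), (13, 9, 7, 1), 1, 1⟩,
    ⟨(11, 17, 1, 3), (13, 9, 7, 1), 1, 0⟩, ⟨(6, 1, 14, 8), (13, 9, 7, 1), 0, 1⟩,
    ⟨(14, 11, 6, 1), (13, 9, 7, 1), 0, 0⟩]

theorem isGenealogy_genealogy : IsGenealogy (imgQuad 14) genealogy := by
  decide +kernel

/-- The tile `a` occurs in the `m`-th image of the tile `b`. -/
def ReachedIn (a : Fin 19) : ℕ → Fin 19 → Prop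
  | 0, b => a = b
  | m + 1, b => ∃ i < 2, ∃ j < 2, i < wd b ∧ j < ht b ∧ ReachedIn a m ((imgQuad b).get i j)

instance (a : Fin 19) : (m : ℕ) → (b : Fin 19) → Decidable (ReachedIn a m b)
  | 0, b => inferInstanceAs (Decidable (a = b))
  | m + 1, _ =>
    have := instDecidableReachedIn a m
    inferInstanceAs (Decidable (∃ i < 2, ∃ j < 2, _ ∧ _ ∧ _))

theorem ReachedIn.isFactor {a : Fin 19} {m : ℕ} : ∀ {b : Fin 19}, ReachedIn a m b →
    (Word.single (tile a)).IsFactor (omega.apply^[m] (Word.single (tile b))) := by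
  induction m with
  | zero => rintro b rfl; exact .refl _
  | succ m ih =>
    rintro b ⟨i, -, j, -, hi, hj, h⟩
    rw [Function.iterate_succ_apply]
    refine (ih h).trans (Substitution.isFactor_iterate
      (Substitution.isValid_apply (isValid_single _)) ⟨i, j, fun p q c hc => ?_⟩ m)
    obtain ⟨hp, hq, rfl⟩ := Word.at_iff.1 hc
    simp only [Word.width_single, Word.height_single, Nat.lt_one_iff] at hp hq
    subst hp hq
    exact omega.apply_single_at.2 ⟨by rwa [omega_width, idx_tile], by rwa [omega_height, idx_tile],
      by rw [omega_img, idx_tile]; rfl⟩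

theorem occursEverywhere_imgQuad : omega.OccursEverywhere (block (imgQuad 14)) := by
  have h : ∀ b, ReachedIn 14 4 b := by decide +kernel
  have h' : omega.OccursEverywhere (Word.single (tile 14)) :=
    ⟨4, fun t => tile_idx t ▸ (h (idx t)).isFactor⟩
  refine (h'.iterate 1).of_isFactor ⟨0, 0, fun p q c hc => ?_⟩
  obtain ⟨hp, hq, rfl⟩ := Word.at_iff.1 hc
  rw [get_block _ hp hq, zero_add, zero_add]
  exact omega.apply_single_at.2 ⟨hp, hq, by rw [omega_img, idx_tile]⟩

/-- The squares whose pairs of tiles occur in tilings. The first one does not occur in tilings,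
though this cannot be seen from its pairs. -/
theorem eq_or_mem_genealogy : ∀ a, ∀ b ∈ toRight a, ∀ d ∈ toUp a, ∀ e ∈ toRight d, e ∈ toUp b →
    ((a, b, d, e) : Quad) = (10, 14, 1, 2) ∨ ((a, b, d, e) : Quad) = imgQuad 14 ∨
      ((a, b, d, e) : Quad) ∈ genealogy.map Descent.child := by
  decide +kernel

theorem eq_of_imgQuad_eq_ten : ∀ t, ∀ i < 2, ∀ j < 2, (imgQuad t).get i j = 10 →
    t = 16 ∧ i = 1 ∧ j = 0 := by
  decide +kernel

theorem imgQuad_of_mem_toRight_sixteen : ∀ t ∈ toRight 16,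
    1 < ht t ∧ ¬((imgQuad t).get 0 0 = 14 ∧ (imgQuad t).get 0 1 = 2) := by
  decide +kernel

/-- The square `(10, 14, 1, 2)` does not occur in tilings: the tile `10` occurs only in the image of
the tile `16`, and no tile to the right of `16` has an image that starts with `14` and `2`. -/
theorem not_occurs_exceptional {z : ℤ × ℤ → tileSetU} (hz : z ∈ tilings tileSetU) (p q : ℤ) :
    ¬(idx (z (p, q)) = 10 ∧ idx (z (p + 1, q)) = 14 ∧ idx (z (p + 1, q + 1)) = 2) := by
  rintro ⟨h1, h2, h3⟩
  obtain ⟨x, hx, X, Y, h⟩ := omega_desubstitutes z hz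
  obtain ⟨i, j, a, b, ha, hb, rfl, rfl⟩ := h.exists_eq_add p q
  have hX := h.width i j
  rw [omega_width] at ha hX
  rw [omega_height] at hb
  have hw := wd_eq_one_or_two (idx (x (i, j)))
  have hh := ht_eq_one_or_two (idx (x (i, j)))
  rw [idx_of_isCutImage h i j ha hb] at h1
  obtain ⟨h4, rfl, rfl⟩ := eq_of_imgQuad_eq_ten _ a (by omega) b (by omega) h1
  obtain ⟨h5, h6⟩ := imgQuad_of_mem_toRight_sixteen _ (h4 ▸ mem_toRight hx i j)
  have hw' := wd_eq_one_or_two (idx (x (i + 1, j)))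
  have e : X i + (1 : ℕ) + 1 = X (i + 1) + (0 : ℕ) := by
    push_cast
    omega
  have h7 := idx_of_isCutImage h (i + 1) j (a := 0) (b := 0) (by omega) (by omega)
  have h8 := idx_of_isCutImage h (i + 1) j (a := 0) (b := 1) (by omega) (by omega)
  rw [← e] at h7 h8
  refine h6 ⟨by rw [← h7, h2], ?_⟩
  rw [← h8, ← h3]
  push_cast
  rw [add_zero]

theorem isMinimal_tileSetU : IsMinimal (wangShift tileSetU) := by
  refine Substitution.isMinimal omega_grows omega_desubstitutes fun z hz p q => ?_
  have hQ : ∀ Q : Quad, Q = (idx (z (p, q)), idx (z (p + 1, q)), idx (z (p, q + 1)),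
      idx (z (p + 1, q + 1))) → omega.OccursEverywhere (block Q) →
      omega.OccursEverywhere (Word.window z p q 2 2 Nat.two_pos Nat.two_pos) := by
    rintro Q rfl h
    refine h.of_isFactor ⟨0, 0, Word.FactorAt.of_get le_rfl le_rfl fun a ha b hb => ?_⟩
    rw [zero_add, zero_add, get_block _ ha hb,
      ← (Word.window_occursAt z p q 2 2 Nat.two_pos Nat.two_pos).get_eq ha hb]
    change a < 2 at ha
    change b < 2 at hb
    interval_cases a <;> interval_cases b <;> simp [Quad.get]
  refine hQ _ rfl ?_
  rcases eq_or_mem_genealogy _ _ (mem_toRight hz p q) _ (mem_toUp hz p q) _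
    (mem_toRight hz p (q + 1)) (mem_toUp hz (p + 1) q) with h | h | h
  · simp only [Prod.mk.injEq] at h
    exact (not_occurs_exceptional hz p q ⟨h.1, h.2.1, h.2.2.2⟩).elim
  · exact h ▸ occursEverywhere_imgQuad
  · exact isGenealogy_genealogy.occursEverywhere occursEverywhere_imgQuad _ h

end WangShift

/-- The Wang shift of the set of 19 Wang tiles is self-similar, aperiodic and minimal. -/
theorem theorem1 :
    WangShift.IsSelfSimilar (WangShift.wangShift WangShift.tileSetU) ∧
      WangShift.IsAperiodic (WangShift.wangShift WangShift.tileSetU) ∧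
      WangShift.IsMinimal (WangShift.wangShift WangShift.tileSetU) :=
  ⟨WangShift.Substitution.isSelfSimilar WangShift.omega_grows WangShift.omega_desubstitutes,
    WangShift.isAperiodic_tileSetU, WangShift.isMinimal_tileSetU⟩
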